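/- Let $n\ge 3$, let $\Omega\subset\mathbb R^n$ be a bounded open set with $0\in\Omega$ (for instance a bounded domain with smooth boundary; no regularity of $\partial\Omega$ is needed), and let $1<p<\frac{n+2}{n-2}$. Assume (A) $k\in C^1[0,\infty)$, $k(0)>0$ and $k'(t)\ge 0$ for all $t\ge 0$. Let $u_0\in H_0^1(\Omega)$ be nonnegative, and consider $$\frac{u_t}{|x|^2}-\Delta u=k(t)u^p\ \text{ in }\Omega\times(0,T),\qquad u=0\ \text{ on }\partial\Omega\times(0,T),\qquad u(x,0)=u_0(x)\ \text{ in }\Omega, \tag{P}$$ where $u^p$ is read as $|u|^{p-1}u$ (this is $u^p$ for nonnegative $u$). For $0<T<\infty$, a weak solution of (P) on $\Omega\times(0,T)$ is a function $u\in L^\infty(0,T;H_0^1(\Omega))$ with $\int_0^T\big\|\frac{u_t(t)}{|x|}\big\|_2^2\,dt<\infty$ and $u(0)=u_0$ such that, for almost every $t\in(0,T)$, $$\int_\Omega\frac{u_t v}{|x|^2}\,dx+\int_\Omega\nabla u\cdot\nabla v\,dx=k(t)\int_\Omega u^p v\,dx\qquad\text{for all } v\in H_0^1(\Omega).$$ Here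 $u$ is taken in its representative that is continuous in time on $[0,T)$ with values in $L^2(\Omega,|x|^{-2}dx)$. We call $u$ a weak solution on $[0,T_0)$, $0<T_0\le\infty$, if it is a weak solution on $\Omega\times(0,T)$ for every finite $T\in(0,T_0)$. It blows up at the finite time $T_0$ if it is a weak solution on $[0,T_0)$ and $\lim_{t\to T_0^-}\big\|\frac{u(t)}{|x|}\big\|_2^2=+\infty$. We say that $T^*\in(0,\infty]$ is the maximal existence time of $u$ if $u$ is a weak solution on $[0,T^*)$ and either $T^*=\infty$ or $\big\|\frac{u(t)}{|x|}\big\|_2$ is unbounded on $[0,T^*)$. Let $$J(v;t)=\frac12\|\nabla v\|_2^2-\frac{k(t)}{p+1}\|v\|_{p+1}^{p+1},\qquad v\in H_0^1(\Omega),\ t\ge 0.$$ Theorem. Suppose that $J(u_0;0)<0$. Then every weak solution of (P) on $\Omega\times(0,T)$ has $$T\le\frac{\big\|u_0/|x|\big\|_2^2}{(1-p^2)\,J(u_0;0)};$$ in particular, no weak solution exists globally in time. Moreover, every weak solution $u$ of (P) with maximal existence time $T^*$ blows up in finite time: $T^*<\infty$, $u$ blows up at $T^*$, and $$T^*\le\frac{\big\|u_0/|x|\big\|_2^2}{(1-p^2)\,J(u_0;0)}.$$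 -/

import Mathlib

open MeasureTheory Set Filter Topology
open scoped ContDiff

noncomputable section

namespace WeightedHeat

/-- The space of pairs `(φ, ∇φ)` with `φ ∈ C_c^∞(Ω)`, as a subspace of `L²(Ω) × L²(Ω; ℝⁿ)`. -/
def testPairs {n : ℕ} (Ω : Set (EuclideanSpace ℝ (Fin n))) :
    Submodule ℝ (Lp ℝ 2 (volume.restrict Ω) ×
      Lp (EuclideanSpace ℝ (Fin n)) 2 (volume.restrict Ω)) where
  carrier := {w | ∃ φ : EuclideanSpace ℝ (Fin n) → ℝ,
    ContDiff ℝ ∞ φ ∧ HasCompactSupport φ ∧ tsupport φ ⊆ Ω ∧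
    w.1 =ᵐ[volume.restrict Ω] φ ∧ w.2 =ᵐ[volume.restrict Ω] gradient φ}
  zero_mem' := by
    refine ⟨fun _ => 0, contDiff_const, HasCompactSupport.zero, by simp [tsupport], ?_, ?_⟩
    · exact Lp.coeFn_zero _ _ _
    · filter_upwards [Lp.coeFn_zero (EuclideanSpace ℝ (Fin n)) 2 (volume.restrict Ω)] with x hx
      rw [gradient_fun_const]
      exact hx
  add_mem' := by
    rintro a b ⟨φ, h1, h2, h3, h4, h5⟩ ⟨ψ, g1, g2, g3, g4, g5⟩
    refine ⟨φ + ψ, h1.add g1, h2.add g2,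
      (tsupport_add φ ψ).trans (union_subset h3 g3), ?_, ?_⟩
    · filter_upwards [Lp.coeFn_add a.1 b.1, h4, g4] with x h h' h''
      simp only [Prod.fst_add, Pi.add_apply, h, h', h'']
    · filter_upwards [Lp.coeFn_add a.2 b.2, h5, g5] with x h h' h''
      simp only [Prod.snd_add, Pi.add_apply, h, h', h'', gradient]
      rw [fderiv_add (h1.differentiable (by simp) x) (g1.differentiable (by simp) x), map_add]
  smul_mem' := by
    rintro c a ⟨φ, h1, h2, h3, h4, h5⟩
    refine ⟨fun x => c * φ x, contDiff_const.mul h1, h2.mul_left,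
      (tsupport_mul_subset_right (f := fun _ => c) (g := φ)).trans h3, ?_, ?_⟩
    · filter_upwards [Lp.coeFn_smul c a.1, h4] with x h h'
      simp only [Prod.smul_fst, Pi.smul_apply, h, h', smul_eq_mul]
    · filter_upwards [Lp.coeFn_smul c a.2, h5] with x h h'
      simp only [Prod.smul_snd, Pi.smul_apply, h, h', gradient]
      rw [fderiv_const_mul (h1.differentiable (by simp) x), map_smul]

/-- The Sobolev space `H₀¹(Ω)`: the closure of `C_c^∞(Ω)` in the norm of `H¹(Ω)`. An element is
stored as the pair `(v, ∇v)`; the second component is determined by the first, being its weak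
gradient. The norm inherited from the product is equivalent to the usual one. -/
abbrev H01 {n : ℕ} (Ω : Set (EuclideanSpace ℝ (Fin n))) : Type :=
  (testPairs Ω).topologicalClosure

variable {n : ℕ} {Ω : Set (EuclideanSpace ℝ (Fin n))}

/-- The function underlying an element of `H₀¹(Ω)`. -/
def H01.fn (v : H01 Ω) : EuclideanSpace ℝ (Fin n) → ℝ := v.1.1

/-- The weak gradient of an element of `H₀¹(Ω)`. -/
def H01.grad (v : H01 Ω) : EuclideanSpace ℝ (Fin n) → EuclideanSpace ℝ (Fin n) := v.1.2

/-- `‖v/|x|‖₂² = ∫_Ω v²/|x|² dx`. -/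
def weightedNormSq (v : H01 Ω) : ℝ := ∫ x in Ω, (v.fn x) ^ 2 / ‖x‖ ^ 2

/-- The energy `J(v;t) = ½ ‖∇v‖₂² - k(t)/(p+1) ‖v‖_{p+1}^{p+1}`. -/
def energy (p : ℝ) (k : ℝ → ℝ) (v : H01 Ω) (t : ℝ) : ℝ :=
  1 / 2 * (∫ x in Ω, ‖v.grad x‖ ^ 2) - k t / (p + 1) * ∫ x in Ω, |v.fn x| ^ (p + 1)

/-- The measure `|x|⁻² dx` on `Ω`. -/
def weightedMeasure (Ω : Set (EuclideanSpace ℝ (Fin n))) :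
    Measure (EuclideanSpace ℝ (Fin n)) :=
  (volume.restrict Ω).withDensity fun x => ENNReal.ofReal ((‖x‖ ^ 2)⁻¹)

/-- `ut` is the time derivative of `u` on `(0,T)` and `∫₀ᵀ ‖u_t/|x|‖₂² dt < ∞`:
`ut` belongs to `L²(0,T; L²(Ω, |x|⁻² dx))`, and `u(t) = u(0) + ∫₀ᵗ ut(s) ds` on `[0,T)`
(Bochner integral in `L²(Ω, |x|⁻² dx)`). -/
structure HasTimeDeriv (T : ℝ) (u : ℝ → H01 Ω) (ut : ℝ → Lp ℝ 2 (weightedMeasure Ω)) : Prop where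
  memLp : MemLp ut 2 (volume.restrict (Ioo 0 T))
  eq_integral : ∀ t ∈ Ico 0 T,
    (u t).fn =ᵐ[volume.restrict Ω]
      fun x => (u 0).fn x + (∫ s in (0 : ℝ)..t, ut s : Lp ℝ 2 (weightedMeasure Ω)) x

/-- `u` is a weak solution on `Ω × (0,T)` of `u_t/|x|² - Δu = k(t) u^p` with zero Dirichlet data
and `u(0) = u₀`. The power `u^p` is read as `|u|^(p-1) u`, which is `u^p` for nonnegative `u`. -/
structure IsWeakSolution (p : ℝ) (k : ℝ → ℝ) (u₀ : H01 Ω) (T : ℝ) (u : ℝ → H01 Ω) : Prop where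
  pos : 0 < T
  memLp : MemLp u ⊤ (volume.restrict (Ioo 0 T))
  initial : u 0 = u₀
  weak : ∃ ut : ℝ → Lp ℝ 2 (weightedMeasure Ω), HasTimeDeriv T u ut ∧
    ∀ᵐ t ∂(volume.restrict (Ioo 0 T)), ∀ v : H01 Ω,
      (∫ x in Ω, ut t x * v.fn x / ‖x‖ ^ 2) + (∫ x in Ω, inner ℝ ((u t).grad x) (v.grad x)) =
        k t * ∫ x in Ω, |(u t).fn x| ^ (p - 1) * (u t).fn x * v.fn x

/-- `u` blows up at the finite time `T₀`: it is a weak solution on `[0,T₀)`, that is, on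
`Ω × (0,T)` for each `T < T₀`, and `‖u(t)/|x|‖₂² → +∞` as `t → T₀`. -/
structure BlowsUpAt (p : ℝ) (k : ℝ → ℝ) (u₀ : H01 Ω) (u : ℝ → H01 Ω) (T₀ : ℝ) : Prop where
  pos : 0 < T₀
  sol : ∀ T ∈ Ioo 0 T₀, IsWeakSolution p k u₀ T u
  tendsto : Tendsto (fun t => weightedNormSq (u t)) (𝓝[<] T₀) atTop

/-- `Tstar ∈ (0,∞]` is the maximal existence time of the weak solution `u`: `u` is a weak solution
on `[0,Tstar)`, and either `Tstar = ∞` or `‖u(t)/|x|‖₂` does not stay bounded on `[0,Tstar)`.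
In the second case only unboundedness is asked, not divergence to infinity. -/
structure IsMaximalExistenceTime (p : ℝ) (k : ℝ → ℝ) (u₀ : H01 Ω) (u : ℝ → H01 Ω)
    (Tstar : EReal) : Prop where
  pos : 0 < Tstar
  sol : ∀ T : ℝ, 0 < T → (T : EReal) < Tstar → IsWeakSolution p k u₀ T u
  unbounded : ∀ T₀ : ℝ, Tstar = T₀ → ¬ BddAbove ((fun t => weightedNormSq (u t)) '' Ico 0 T₀)

end WeightedHeat

end

/-! The proof is Levine's concavity method. Put L(t) = ½ ‖u(t)/|x|‖² and M(t) = -J(u₀;0) + ∫₀ᵗ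
‖u_t/|x|‖² ds, so that L(0) > 0 and M ≥ M(0) > 0. Testing the equation with u gives L' = -(p+1)
J(u;t) + (p-1)/2 ‖∇u‖², and the energy inequality J(u(t);t) + ∫₀ᵗ ‖u_t/|x|‖² ≤ J(u₀;0) turns this
into L' ≥ (p+1) M. Cauchy–Schwarz gives L'² ≤ 2 L M'. With α = (p+1)/2 it follows that M L^(-α) is
nondecreasing, hence L' L^(-α) stays above a positive constant, and L^(1-α), which is positive,
decreases at least linearly. This bounds the life span (`le_of_superlinear_growth`). Since L is
nondecreasing, unboundedness of L on [0,T*) is already divergence.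

The delicate point is the energy inequality: u_t takes values only in L²(|x|⁻² dx), so it is not an
admissible test function. The equation at time t is tested with u(t) - u(s) instead. On bounded sets
of H₀¹ the energy is semiconvex with respect to the weighted norm (`exists_energy_sub_le`), whence
J(u(t);t) - J(u(s);s) ≤ -(u_t(t), u(t)-u(s)) + C ‖u(t)-u(s)‖² in the weighted space. Taking s = t -
σ, integrating in t, dividing by σ and letting σ → 0 yields the inequality for almost every t
(`energy_add_dissipation_le`), because the quadratic error is o(σ) after integration.

Semiconvexity rests on Sobolev's inequality and on p being strictly subcritical: the error ∫
|v|^(p-1) w² is a small multiple of ‖∇w‖², absorbed by the Dirichlet form, plus a multiple of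
‖w/|x|‖². Hardy's inequality (`exists_hardy`) embeds H₀¹ into the weighted space. -/

open scoped NNReal

/-! ### Absolutely continuous functions -/

namespace AbsolutelyContinuousOnInterval

theorem of_dist_le {X Y : Type*} [PseudoMetricSpace X] [PseudoMetricSpace Y] {f : ℝ → X}
    {g : ℝ → Y} {a b K : ℝ} (hg : AbsolutelyContinuousOnInterval g a b)
    (h : ∀ x ∈ uIcc a b, ∀ y ∈ uIcc a b, dist (f x) (f y) ≤ K * dist (g x) (g y)) :
    AbsolutelyContinuousOnInterval f a b := by
  rw [absolutelyContinuousOnInterval_iff] at hg ⊢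
  intro ε hε
  obtain ⟨δ, hδ, H⟩ := hg (ε / (|K| + 1)) (by positivity)
  refine ⟨δ, hδ, fun E hE hlen ↦ ?_⟩
  have h1 := H E hE hlen
  have h2 : ∑ i ∈ Finset.range E.1, dist (f (E.2 i).1) (f (E.2 i).2) ≤
      (|K| + 1) * ∑ i ∈ Finset.range E.1, dist (g (E.2 i).1) (g (E.2 i).2) := by
    rw [Finset.mul_sum]
    refine Finset.sum_le_sum fun i hi ↦ (h _ (hE.1 i hi).1 _ (hE.1 i hi).2).trans ?_
    gcongr
    exact (le_abs_self K).trans (by linarith)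
  refine h2.trans_lt ?_
  rwa [lt_div_iff₀' (by positivity)] at h1

theorem le_of_ae_hasDerivAt_nonneg {f : ℝ → ℝ} {a b : ℝ} (hab : a ≤ b)
    (hf : AbsolutelyContinuousOnInterval f a b)
    (h : ∀ᵐ x, x ∈ Ioo a b → ∃ f', HasDerivAt f f' x ∧ 0 ≤ f') : f a ≤ f b := by
  have h1 := hf.integral_deriv_eq_sub
  rw [intervalIntegral.integral_of_le hab, integral_Ioc_eq_integral_Ioo] at h1
  have h2 : 0 ≤ ∫ x in Ioo a b, deriv f x := by
    refine integral_nonneg_of_ae ?_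
    filter_upwards [ae_restrict_mem measurableSet_Ioo, ae_restrict_of_ae h] with x hx hx'
    obtain ⟨f', hf', h0⟩ := hx' hx
    simpa [hf'.deriv] using h0
  linarith

/-- An absolutely continuous function is bounded, and a power is Lipschitz on a compact interval
away from 0. -/
theorem rpow_const {f : ℝ → ℝ} {a b c : ℝ} (hc : 0 < c)
    (hf : AbsolutelyContinuousOnInterval f a b) (hfc : ∀ x ∈ uIcc a b, c ≤ f x) (r : ℝ) :
    AbsolutelyContinuousOnInterval (fun x ↦ f x ^ r) a b := by
  obtain ⟨C, hC⟩ := hf.exists_bound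
  have hsub : ∀ x ∈ uIcc a b, f x ∈ Icc c C := fun x hx ↦
    ⟨hfc x hx, (le_abs_self _).trans (hC x hx)⟩
  have hcd : ContDiffOn ℝ 1 (fun x : ℝ ↦ x ^ r) (Icc c C) := fun x hx ↦
    (Real.contDiffAt_rpow_const_of_ne (hc.trans_le hx.1).ne').contDiffWithinAt
  obtain ⟨K, hK⟩ := hcd.exists_lipschitzOnWith (by decide) (convex_Icc _ _) isCompact_Icc
  exact hf.of_dist_le (K := K) fun x hx y hy ↦ hK.dist_le_mul _ (hsub x hx) _ (hsub y hy)

end AbsolutelyContinuousOnInterval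

/-! ### The concavity method for a pair of differential inequalities -/

namespace WeightedHeat

/-- An absolutely continuous function with nonnegative derivative almost everywhere is
nondecreasing. -/
theorem monotoneOn_of_ae_hasDerivAt {L : ℝ → ℝ} {a b : ℝ}
    (hL : AbsolutelyContinuousOnInterval L a b) (hab : a ≤ b)
    (h : ∀ᵐ t, t ∈ Ioo a b → ∃ l, HasDerivAt L l t ∧ 0 ≤ l) : MonotoneOn L (Icc a b) := by
  intro s hs t ht hst
  refine (hL.mono ?_).le_of_ae_hasDerivAt_nonneg hst ?_
  · rw [uIcc_of_le hst, uIcc_of_le hab]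
    exact Icc_subset_Icc hs.1 ht.2
  · filter_upwards [h] with x hx hx'
    exact hx ⟨hs.1.trans_lt hx'.1, hx'.2.trans_le ht.2⟩

/-- The concavity method: if `L' ≥ 2 α M` and `L'² ≤ 2 L M'` almost everywhere on `(0, b)` with
`α > 1` and positive data, then `b` is at most `L(0) / (2 α (α - 1) M(0))`. -/
theorem le_of_superlinear_growth {L M : ℝ → ℝ} {α b : ℝ} (hα : 1 < α) (hb : 0 ≤ b)
    (hL : AbsolutelyContinuousOnInterval L 0 b) (hM : AbsolutelyContinuousOnInterval M 0 b)
    (hL0 : 0 < L 0) (hM0 : 0 < M 0) (hMpos : ∀ t ∈ Icc 0 b, M 0 ≤ M t)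
    (h : ∀ᵐ t, t ∈ Ioo 0 b → ∃ l m, HasDerivAt L l t ∧ HasDerivAt M m t ∧
      2 * α * M t ≤ l ∧ l ^ 2 ≤ 2 * L t * m) :
    b ≤ L 0 / (2 * α * (α - 1) * M 0) := by
  have hα0 : 0 < α := by linarith
  have hLmono : MonotoneOn L (Icc 0 b) := by
    refine monotoneOn_of_ae_hasDerivAt hL hb ?_
    filter_upwards [h] with t ht htm
    obtain ⟨l, m, hl, -, hlm, -⟩ := ht htm
    have := hMpos t ⟨htm.1.le, htm.2.le⟩
    exact ⟨l, hl, le_trans (by have := hM0.trans_le this; positivity) hlm⟩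
  have hLpos : ∀ t ∈ Icc 0 b, L 0 ≤ L t := fun t ht ↦ hLmono ⟨le_rfl, hb⟩ ht ht.1
  have hLu : ∀ t ∈ uIcc 0 b, L 0 ≤ L t := by rwa [uIcc_of_le hb]
  have hLr := fun r ↦ hL.rpow_const hL0 hLu r
  -- `M L^{-α}` is nondecreasing
  have hZ : MonotoneOn (fun t ↦ M t * L t ^ (-α)) (Icc 0 b) := by
    refine monotoneOn_of_ae_hasDerivAt (hM.mul (hLr (-α))) hb ?_
    filter_upwards [h] with t ht htm
    obtain ⟨l, m, hl, hm, hlm, hlm2⟩ := ht htm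
    have hLt : 0 < L t := hL0.trans_le (hLpos t ⟨htm.1.le, htm.2.le⟩)
    have hMt : 0 < M t := hM0.trans_le (hMpos t ⟨htm.1.le, htm.2.le⟩)
    refine ⟨_, hm.mul (hl.rpow_const (p := -α) (Or.inl hLt.ne')), ?_⟩
    have hl0 : 0 < l := lt_of_lt_of_le (by positivity) hlm
    have e : L t ^ (-α) = L t ^ (-α - 1) * L t := by
      rw [← Real.rpow_add_one hLt.ne']; ring_nf
    have hp : 0 < L t ^ (-α - 1) := Real.rpow_pos_of_pos hLt _
    -- Multiply `2 α M ≤ l` by `l > 0` and compare with `l² ≤ 2 L m`; this is the sign of the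
    -- derivative of `M L^(-α)`.
    have hkey : α * M t * l ≤ m * L t := by nlinarith
    rw [e]
    nlinarith
  set Z := M 0 * L 0 ^ (-α) with hZdef
  have hZ0 : 0 < Z := mul_pos hM0 (Real.rpow_pos_of_pos hL0 _)
  -- The derivative of `-L^(1-α)` is `(α-1) l L^(-α)`, and `l L^(-α) ≥ 2 α M L^(-α) ≥ 2 α Z`.
  -- Positivity of `L(b)^(1-α)` then limits `b`.
  have hQ : MonotoneOn (fun t ↦ -(L t ^ (1 - α)) - (2 * α * (α - 1) * Z) * t) (Icc 0 b) := by
    have hid : AbsolutelyContinuousOnInterval (fun t : ℝ ↦ t) 0 b :=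
      (contDiff_id.contDiffOn).absolutelyContinuousOnInterval
    refine monotoneOn_of_ae_hasDerivAt ((hLr (1 - α)).neg.sub (hid.const_mul _)) hb ?_
    filter_upwards [h] with t ht htm
    obtain ⟨l, m, hl, hm, hlm, -⟩ := ht htm
    have htI : t ∈ Icc 0 b := ⟨htm.1.le, htm.2.le⟩
    have hLt : 0 < L t := hL0.trans_le (hLpos t htI)
    refine ⟨_, (hl.rpow_const (p := 1 - α) (Or.inl hLt.ne')).neg.sub
      ((hasDerivAt_id t).const_mul (2 * α * (α - 1) * Z)), ?_⟩
    have h1 : Z ≤ M t * L t ^ (-α) := hZ ⟨le_rfl, hb⟩ htI htm.1.le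
    have hp : 0 < L t ^ (-α) := Real.rpow_pos_of_pos hLt _
    have e : 1 - α - 1 = -α := by ring
    rw [e]
    have h2 : 2 * α * Z ≤ l * L t ^ (-α) := by nlinarith
    have h3 := mul_le_mul_of_nonneg_left h2 (sub_pos.2 hα).le
    nlinarith
  have h1 := hQ ⟨le_rfl, hb⟩ ⟨hb, le_rfl⟩ hb
  have h2 : 0 < L b ^ (1 - α) := Real.rpow_pos_of_pos (hL0.trans_le (hLpos b ⟨hb, le_rfl⟩)) _
  have e : L 0 ^ (1 - α) = L 0 ^ (-α) * L 0 := by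
    rw [← Real.rpow_add_one hL0.ne']; ring_nf
  have hp : 0 < L 0 ^ (-α) := Real.rpow_pos_of_pos hL0 _
  have h3 : 2 * α * (α - 1) * Z * b ≤ L 0 ^ (-α) * L 0 := by
    rw [← e]; simp only [mul_zero] at h1; linarith
  have hα1 : 0 < α - 1 := by linarith
  rw [le_div_iff₀ (by positivity)]
  rw [hZdef] at h3
  refine le_of_mul_le_mul_left ?_ hp
  linarith

end WeightedHeat

/-! ### From a differenced energy inequality to the integrated one -/

namespace WeightedHeat

/-- A form of Fatou's lemma: an upper bound on the integrals of nonnegative functions passes to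
the integral of the pointwise limit. -/
theorem integral_le_of_ae_tendsto_of_le {α : Type*} [MeasurableSpace α] {μ : Measure α}
    {f : ℕ → α → ℝ} {g : α → ℝ} {A : ℕ → ℝ} {a : ℝ} (hf : ∀ k, Integrable (f k) μ)
    (hf0 : ∀ k, 0 ≤ᵐ[μ] f k) (hg : Integrable g μ)
    (hlim : ∀ᵐ x ∂μ, Tendsto (fun k ↦ f k x) atTop (𝓝 (g x)))
    (hle : ∀ᶠ k in atTop, ∫ x, f k x ∂μ ≤ A k) (hA : Tendsto A atTop (𝓝 a)) :
    ∫ x, g x ∂μ ≤ a := by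
  have hg0 : 0 ≤ᵐ[μ] g := by
    filter_upwards [hlim, ae_all_iff.2 hf0] with x hx h0
    exact ge_of_tendsto' hx h0
  have ha : 0 ≤ a := ge_of_tendsto hA
    (hle.mono fun k hk ↦ (integral_nonneg_of_ae (hf0 k)).trans hk)
  rw [← ENNReal.ofReal_le_ofReal_iff ha, ofReal_integral_eq_lintegral_ofReal hg hg0]
  calc ∫⁻ x, ENNReal.ofReal (g x) ∂μ
      = ∫⁻ x, liminf (fun k ↦ ENNReal.ofReal (f k x)) atTop ∂μ := by
        refine lintegral_congr_ae ?_
        filter_upwards [hlim] with x hx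
        exact ((ENNReal.continuous_ofReal.tendsto _).comp hx).liminf_eq.symm
    _ ≤ liminf (fun k ↦ ∫⁻ x, ENNReal.ofReal (f k x) ∂μ) atTop :=
        lintegral_liminf_le' fun k ↦ (hf k).1.aemeasurable.ennreal_ofReal
    _ ≤ liminf (fun k ↦ ENNReal.ofReal (A k)) atTop := by
        refine liminf_le_liminf ?_
        filter_upwards [hle] with k hk
        rw [← ofReal_integral_eq_lintegral_ofReal (hf k) (hf0 k)]
        exact ENNReal.ofReal_le_ofReal hk
    _ = ENNReal.ofReal a := ((ENNReal.continuous_ofReal.tendsto _).comp hA).liminf_eq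

variable {H : Type*} [NormedAddCommGroup H] [InnerProductSpace ℝ H]

/-- The Cauchy–Schwarz inequality in time for the integral of a function in `L²`. -/
theorem norm_intervalIntegral_sq_le {g : ℝ → H} {s t : ℝ} (hst : s < t)
    (hg : IntervalIntegrable g volume s t)
    (hg2 : IntervalIntegrable (fun r ↦ ‖g r‖ ^ 2) volume s t) :
    ‖∫ r in s..t, g r‖ ^ 2 ≤ (t - s) * ∫ r in s..t, ‖g r‖ ^ 2 := by
  set A := ∫ r in s..t, ‖g r‖
  set N := ∫ r in s..t, ‖g r‖ ^ 2
  have hA : ‖∫ r in s..t, g r‖ ≤ A := intervalIntegral.norm_integral_le_integral_norm hst.le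
  have hts : 0 < t - s := sub_pos.2 hst
  -- The mean of `‖g‖` over the interval; the inequality says that the variance of `‖g‖` is
  -- nonnegative.
  set c := A / (t - s)
  have h0 : 0 ≤ ∫ r in s..t, (‖g r‖ ^ 2 - 2 * c * ‖g r‖ + c ^ 2) :=
    intervalIntegral.integral_nonneg hst.le fun r _ ↦ by nlinarith [sq_nonneg (‖g r‖ - c)]
  rw [intervalIntegral.integral_add (hg2.sub (hg.norm.const_mul _)) intervalIntegrable_const,
    intervalIntegral.integral_sub hg2 (hg.norm.const_mul _),
    intervalIntegral.integral_const_mul, intervalIntegral.integral_const, smul_eq_mul] at h0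
  change 0 ≤ N - 2 * c * A + (t - s) * c ^ 2 at h0
  have hcA : c * (t - s) = A := div_mul_cancel₀ _ hts.ne'
  have hA2 : A ^ 2 ≤ (t - s) * N := by
    rw [← hcA] at h0 ⊢
    nlinarith
  exact (pow_le_pow_left₀ (norm_nonneg _) hA 2).trans hA2

theorem intervalIntegral_comp_sub_sub {f : ℝ → ℝ} (hf : ∀ a b, IntervalIntegrable f volume a b)
    (b h : ℝ) :
    ∫ t in (0 : ℝ)..b, (f t - f (t - h)) = (∫ t in (b - h)..b, f t) - ∫ t in (-h)..0, f t := by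
  have h1 : IntervalIntegrable (fun t ↦ f (t - h)) volume 0 b := by
    simpa using (hf (0 - h) (b - h)).comp_sub_right h
  rw [intervalIntegral.integral_sub (hf _ _) h1, intervalIntegral.integral_comp_sub_right, zero_sub]
  have e1 := intervalIntegral.integral_add_adjacent_intervals (hf (-h) 0) (hf 0 b)
  have e2 := intervalIntegral.integral_add_adjacent_intervals (hf (-h) (b - h)) (hf (b - h) b)
  linarith

variable [CompleteSpace H]

/-- A differentiated energy inequality with a quadratic error, on the whole line, with data that
are constant before time `0`. -/
theorem energy_add_dissipation_le_aux {G : ℝ → H} {j : ℝ → ℝ} {C b j₀ : ℝ} (hb : 0 < b)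
    (hC : 0 ≤ C)
    (hG : Integrable G) (hG2 : Integrable fun t ↦ ‖G t‖ ^ 2) (hG0 : ∀ t ≤ 0, G t = 0)
    (hj : ∀ a b, IntervalIntegrable j volume a b) (hj0 : ∀ t ≤ 0, j t = j₀)
    (hjb : HasDerivAt (fun t ↦ ∫ s in (0 : ℝ)..t, j s) (j b) b)
    (h : ∀ σ > 0, ∀ᵐ t, t ∈ Ioo 0 b → j t - j (t - σ) ≤
      -inner ℝ (G t) (∫ s in (t - σ)..t, G s) + C * ‖∫ s in (t - σ)..t, G s‖ ^ 2) :
    j b + ∫ s in (0 : ℝ)..b, ‖G s‖ ^ 2 ≤ j₀ := by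
  set N : ℝ → ℝ := fun t ↦ ∫ s in (0 : ℝ)..t, ‖G s‖ ^ 2 with hN
  have hGi : ∀ a b, IntervalIntegrable G volume a b := fun _ _ ↦ hG.intervalIntegrable
  have hGi2 : ∀ a b, IntervalIntegrable (fun t ↦ ‖G t‖ ^ 2) volume a b :=
    fun _ _ ↦ hG2.intervalIntegrable
  have hNsub : ∀ s t, N t - N s = ∫ r in s..t, ‖G r‖ ^ 2 := fun s t ↦
    intervalIntegral.integral_interval_sub_left (hGi2 _ _) (hGi2 _ _)
  have hNmono : Monotone N := fun s t hst ↦ by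
    have := intervalIntegral.integral_nonneg (μ := volume) hst fun r _ ↦ sq_nonneg ‖G r‖
    linarith [hNsub s t]
  have hN0 : ∀ t ≤ 0, N t = 0 := fun t ht ↦ by
    have : ∫ s in (0 : ℝ)..t, ‖G s‖ ^ 2 = ∫ s in (0 : ℝ)..t, (0 : ℝ) :=
      intervalIntegral.integral_congr fun s hs ↦ by
        rw [uIcc_of_ge ht] at hs
        simp [hG0 s hs.2]
    simpa [hN] using this
  have hNi : ∀ a b, IntervalIntegrable N volume a b := fun a b ↦ hNmono.intervalIntegrable
  set σ : ℕ → ℝ := fun k ↦ 1 / ((k : ℝ) + 1) with hσ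
  have hσ0 : ∀ k, 0 < σ k := fun k ↦ by positivity
  have hσlim : Tendsto σ atTop (𝓝 0) := tendsto_one_div_add_atTop_nhds_zero_nat
  set D : ℕ → ℝ → H := fun k t ↦ (σ k)⁻¹ • ∫ s in (t - σ k)..t, G s with hD
  have hYc : Continuous fun t ↦ ∫ s in (0 : ℝ)..t, G s := intervalIntegral.continuous_primitive
    (fun a b ↦ hGi a b) 0
  have hDc : ∀ k, Continuous (D k) := fun k ↦ by
    have : D k = fun t ↦ (σ k)⁻¹ • ((∫ s in (0 : ℝ)..t, G s) - ∫ s in (0 : ℝ)..(t - σ k), G s) := by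
      ext1 t
      simp only [hD]
      rw [intervalIntegral.integral_interval_sub_left (hGi _ _) (hGi _ _)]
    rw [this]
    exact (hYc.sub (hYc.comp (continuous_id.sub continuous_const))).const_smul _
  set μ := volume.restrict (Ioc 0 b) with hμ
  have hGμ : MemLp G 2 μ :=
    (memLp_two_iff_integrable_sq_norm hG.1.restrict).2 hG2.integrableOn
  have hfi : ∀ k, Integrable (fun t ↦ 1 / 2 * ‖G t + D k t‖ ^ 2) μ := fun k ↦ by
    have hDμ : MemLp (D k) 2 μ := by
      rw [memLp_two_iff_integrable_sq_norm (hDc k).aestronglyMeasurable]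
      exact (((hDc k).norm.pow 2).integrableOn_Icc).mono_set Ioc_subset_Icc_self
    have := (hGμ.add hDμ)
    exact ((memLp_two_iff_integrable_sq_norm this.1).1 this).const_mul _
  -- pointwise inequality, after completing the square
  have hpt : ∀ k, ∀ᵐ t, t ∈ Ioo 0 b → σ k * (1 / 2 * ‖G t + D k t‖ ^ 2) ≤
      -(j t - j (t - σ k)) + σ k / 2 * ‖G t‖ ^ 2 +
        (1 / 2 + C * σ k) * (N t - N (t - σ k)) := fun k ↦ by
    filter_upwards [h (σ k) (hσ0 k)] with t ht htm
    have h1 := ht htm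
    have h2 := norm_intervalIntegral_sq_le (sub_lt_self t (hσ0 k)) (hGi (t - σ k) t) (hGi2 _ _)
    rw [← hNsub, sub_sub_cancel] at h2
    have e : ∫ s in (t - σ k)..t, G s = σ k • D k t := by
      simp only [hD]
      rw [smul_inv_smul₀ (hσ0 k).ne']
    rw [e, norm_smul, mul_pow, Real.norm_of_nonneg (hσ0 k).le] at h2
    rw [e, norm_smul, mul_pow, Real.norm_of_nonneg (hσ0 k).le, real_inner_smul_right] at h1
    rw [norm_add_sq_real]
    have hs := hσ0 k
    have h3 : σ k * ‖D k t‖ ^ 2 ≤ N t - N (t - σ k) := by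
      refine le_of_mul_le_mul_left ?_ hs
      linarith
    have h4 : C * (σ k ^ 2 * ‖D k t‖ ^ 2) ≤ C * σ k * (N t - N (t - σ k)) := by
      have := mul_le_mul_of_nonneg_left h3 (mul_nonneg hC hs.le)
      linarith
    linarith
  -- The differences telescope into averages over intervals of length `σ k` at the two ends. Since
  -- `N` vanishes before time 0 and is monotone, its difference contributes at most `σ k * N b`, so
  -- the factor `C σ k` disappears in the limit.
  have hint : ∀ k, ∫ t, 1 / 2 * ‖G t + D k t‖ ^ 2 ∂μ ≤
      (j₀ - (σ k)⁻¹ * ∫ t in (b - σ k)..b, j t) + 1 / 2 * N b + (1 / 2 + C * σ k) * N b := fun k ↦ by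
    have hs := hσ0 k
    have hshift : ∀ {f : ℝ → ℝ}, (∀ a b, IntervalIntegrable f volume a b) →
        IntervalIntegrable (fun t ↦ f t - f (t - σ k)) volume 0 b := fun {f} hf ↦
      (hf 0 b).sub (by simpa using (hf (0 - σ k) (b - σ k)).comp_sub_right (σ k))
    have i1 : IntervalIntegrable (fun t ↦ -(j t - j (t - σ k))) volume 0 b := (hshift hj).neg
    have i2 : IntervalIntegrable (fun t ↦ σ k / 2 * ‖G t‖ ^ 2) volume 0 b :=
      (hGi2 _ _).const_mul _
    have i3 : IntervalIntegrable (fun t ↦ (1 / 2 + C * σ k) * (N t - N (t - σ k))) volume 0 b :=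
      (hshift hNi).const_mul _
    have h1 : ∫ t in (0 : ℝ)..b, σ k * (1 / 2 * ‖G t + D k t‖ ^ 2) ≤
        ∫ t in (0 : ℝ)..b, (-(j t - j (t - σ k)) + σ k / 2 * ‖G t‖ ^ 2 +
        (1 / 2 + C * σ k) * (N t - N (t - σ k))) := by
      refine intervalIntegral.integral_mono_ae_restrict hb.le
        (((intervalIntegrable_iff_integrableOn_Ioc_of_le hb.le).2 (hfi k)).const_mul _)
        ((i1.add i2).add i3) ?_
      filter_upwards [ae_restrict_mem measurableSet_Icc, ae_restrict_of_ae (hpt k),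
        ae_restrict_of_ae (Measure.ae_ne volume 0), ae_restrict_of_ae (Measure.ae_ne volume b)]
        with t h1 h2 h3 h4
      exact h2 ⟨lt_of_le_of_ne h1.1 (Ne.symm h3), lt_of_le_of_ne h1.2 h4⟩
    rw [intervalIntegral.integral_const_mul (σ k), intervalIntegral.integral_add (i1.add i2) i3,
      intervalIntegral.integral_add i1 i2,
      intervalIntegral.integral_neg, intervalIntegral.integral_const_mul (σ k / 2),
      intervalIntegral.integral_const_mul (1 / 2 + C * σ k), intervalIntegral_comp_sub_sub hj,
      intervalIntegral_comp_sub_sub hNi] at h1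
    have h2 : ∫ t in (-σ k)..0, j t = σ k * j₀ := by
      rw [intervalIntegral.integral_congr (g := fun _ ↦ j₀)]
      · simp
      · intro t ht
        rw [uIcc_of_le (by linarith)] at ht
        exact hj0 t ht.2
    have h3 : ∫ t in (-σ k)..0, N t = 0 := by
      rw [intervalIntegral.integral_congr (g := fun _ ↦ (0 : ℝ))]
      · simp
      · intro t ht
        rw [uIcc_of_le (by linarith)] at ht
        exact hN0 t ht.2
    have h4 : ∫ t in (b - σ k)..b, N t ≤ σ k * N b := by
      have := intervalIntegral.integral_mono_on (μ := volume) (sub_le_self b hs.le) (hNi _ _)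
        (intervalIntegrable_const (c := N b)) fun t ht ↦ hNmono ht.2
      simpa using this
    rw [h2, h3] at h1
    rw [intervalIntegral.integral_of_le hb.le] at h1
    have h5 : σ k * ∫ t, 1 / 2 * ‖G t + D k t‖ ^ 2 ∂μ ≤
      σ k * ((j₀ - (σ k)⁻¹ * ∫ t in (b - σ k)..b, j t) + 1 / 2 * N b + (1 / 2 + C * σ k) * N b) := by
      refine h1.trans ?_
      have h6 := mul_le_mul_of_nonneg_left h4 (by positivity : 0 ≤ 1 / 2 + C * σ k)
      have h7 : σ k * ((σ k)⁻¹ * ∫ t in (b - σ k)..b, j t) = ∫ t in (b - σ k)..b, j t :=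
        mul_inv_cancel_left₀ hs.ne' _
      simp only [hN] at h6 ⊢
      linear_combination h6 + h7
    exact le_of_mul_le_mul_left h5 hs
  have hσ' : Tendsto (fun k ↦ -σ k) atTop (𝓝[≠] 0) := by
    refine tendsto_nhdsWithin_iff.2 ⟨by simpa using hσlim.neg, .of_forall fun k ↦ ?_⟩
    exact neg_ne_zero.2 (hσ0 k).ne'
  have hjlim : Tendsto (fun k ↦ (σ k)⁻¹ * ∫ t in (b - σ k)..b, j t) atTop (𝓝 (j b)) := by
    have := (hasDerivAt_iff_tendsto_slope_zero.1 hjb).comp hσ'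
    refine this.congr fun k ↦ ?_
    simp only [Function.comp, smul_eq_mul, ← sub_eq_add_neg]
    rw [intervalIntegral.integral_interval_sub_left (hj _ _) (hj _ _),
      intervalIntegral.integral_symm, inv_neg]
    ring
  have hlim := (hjlim.const_sub j₀).add_const (1 / 2 * N b) |>.add
    (((hσlim.const_mul C).const_add (1 / 2)).mul_const (N b))
  have hDlim : ∀ᵐ t ∂μ, Tendsto (fun k ↦ 1 / 2 * ‖G t + D k t‖ ^ 2) atTop
      (𝓝 (2 * ‖G t‖ ^ 2)) := by
    filter_upwards [ae_restrict_of_ae (LocallyIntegrable.ae_hasDerivAt_integral hG.locallyIntegrable)] with t ht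
    have := (hasDerivAt_iff_tendsto_slope_zero.1 (ht 0)).comp hσ'
    have hDt : Tendsto (fun k ↦ D k t) atTop (𝓝 (G t)) := by
      refine this.congr fun k ↦ ?_
      simp only [Function.comp, ← sub_eq_add_neg, hD]
      rw [intervalIntegral.integral_interval_sub_left (hGi _ _) (hGi _ _),
        intervalIntegral.integral_symm, inv_neg, smul_neg, neg_smul, neg_neg]
    have h2 := ((hDt.const_add (G t)).norm.pow 2).const_mul (1 / 2)
    have e : 1 / 2 * ‖G t + G t‖ ^ 2 = 2 * ‖G t‖ ^ 2 := by
      rw [← two_smul ℝ, norm_smul, Real.norm_ofNat]; ring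
    rwa [e] at h2
  -- The product `⟨G, D k⟩` has no sign, but the completed square has one, so almost everywhere
  -- convergence of `D k` to `G` suffices. The limit reads `2 N(b) ≤ j₀ - j(b) + N(b)`.
  have hfin := integral_le_of_ae_tendsto_of_le hfi (fun k ↦ .of_forall fun t ↦ by positivity)
    (hG2.integrableOn.const_mul 2) hDlim (.of_forall hint) hlim
  rw [integral_const_mul, ← intervalIntegral.integral_of_le hb.le] at hfin
  change j b + N b ≤ j₀
  change 2 * N b ≤ _ at hfin
  linarith

/-- If `j` satisfies a differentiated energy inequality with a quadratic error along almost all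
pairs of times, and between almost every time and time `0`, then the energy inequality holds. -/
theorem energy_add_dissipation_le {g : ℝ → H} {j : ℝ → ℝ} {C T : ℝ} (hC : 0 ≤ C) {S : Set ℝ}
    (hS : ∀ᵐ t, t ∈ Ioo 0 T → t ∈ S) (hg : MemLp g 2 (volume.restrict (Ioo 0 T)))
    (hj : IntegrableOn j (Ioo 0 T))
    (h : ∀ t ∈ S, t ∈ Ioo 0 T → ∀ s, s ∈ Ico 0 t → (s = 0 ∨ s ∈ S) → j t - j s ≤
      -inner ℝ (g t) (∫ r in s..t, g r) + C * ‖∫ r in s..t, g r‖ ^ 2) :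
    ∀ᵐ b, b ∈ Ioo 0 T → j b + ∫ s in (0 : ℝ)..b, ‖g s‖ ^ 2 ≤ j 0 := by
  set G := (Ioo 0 T).indicator g with hGdef
  -- Freezing the energy before time 0 makes its average there equal to the initial value, so
  -- continuity of `j` at 0 is not needed.
  set J : ℝ → ℝ := (Iic 0).indicator (fun _ ↦ j 0) + (Ioo 0 T).indicator j with hJdef
  have hGg : ∀ t ∈ Ioo 0 T, G t = g t := fun t ht ↦ indicator_of_mem ht _
  have hG0 : ∀ t ≤ 0, G t = 0 := fun t ht ↦ indicator_of_notMem (fun h ↦ ht.not_gt h.1) _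
  have hJ0 : ∀ t ≤ 0, J t = j 0 := fun t ht ↦ by
    simp [hJdef, ht, not_lt.2 ht]
  have hJj : ∀ t ∈ Ioo 0 T, J t = j t := fun t ht ↦ by
    simp [hJdef, ht.1, ht.2]
  have hG : Integrable G := (integrable_indicator_iff measurableSet_Ioo).2
    (hg.integrable one_le_two)
  have hG2 : Integrable fun t ↦ ‖G t‖ ^ 2 := by
    have : (fun t ↦ ‖G t‖ ^ 2) = (Ioo 0 T).indicator fun t ↦ ‖g t‖ ^ 2 := by
      ext t
      by_cases ht : t ∈ Ioo 0 T <;> simp [hGdef, ht]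
    rw [this, integrable_indicator_iff measurableSet_Ioo]
    exact (memLp_two_iff_integrable_sq_norm hg.1).1 hg
  have hJ : LocallyIntegrable J := by
    refine LocallyIntegrable.add ((locallyIntegrable_const _).indicator measurableSet_Iic) ?_
    exact ((integrable_indicator_iff measurableSet_Ioo).2 hj).locallyIntegrable
  have hJi : ∀ a b, IntervalIntegrable J volume a b := fun a b ↦
    (hJ.integrableOn_isCompact isCompact_uIcc).intervalIntegrable
  have hEq : ∀ {s t : ℝ}, 0 ≤ s → t < T → EqOn G g (Ioc s t) := fun hs ht r hr ↦
    hGg r ⟨hs.trans_lt hr.1, hr.2.trans_lt ht⟩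
  have hint : ∀ {s t : ℝ}, 0 ≤ s → s ≤ t → t < T → ∫ r in s..t, G r = ∫ r in s..t, g r := by
    intro s t hs hst ht
    rw [intervalIntegral.integral_of_le hst, intervalIntegral.integral_of_le hst]
    exact setIntegral_congr_fun measurableSet_Ioc (hEq hs ht)
  filter_upwards [LocallyIntegrable.ae_hasDerivAt_integral hJ] with b hb hbT
  have := energy_add_dissipation_le_aux hbT.1 hC hG hG2 hG0 hJi hJ0 (hb 0) fun σ hσ ↦ by
    -- Translations preserve null sets, so for fixed `σ` both `t` and `t - σ` are good times for
    -- almost every `t`. When `t - σ ≤ 0` the comparison is with time 0 itself.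
    filter_upwards [hS, (measurePreserving_sub_right volume σ).quasiMeasurePreserving.ae hS]
      with t h1 h2 ht
    have htT : t ∈ Ioo 0 T := ⟨ht.1, ht.2.trans hbT.2⟩
    rw [hJj t htT, hGg t htT]
    rcases le_or_gt (t - σ) 0 with h0 | h0
    · have e : ∫ s in (t - σ)..t, G s = ∫ s in (0 : ℝ)..t, g s := by
        rw [← hint le_rfl ht.1.le htT.2,
          ← intervalIntegral.integral_add_adjacent_intervals (b := 0)
          hG.intervalIntegrable hG.intervalIntegrable, add_eq_right,
          intervalIntegral.integral_congr (g := fun _ ↦ (0 : H))]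
        · simp
        · intro r hr
          rw [uIcc_of_le h0] at hr
          exact hG0 r hr.2
      rw [hJ0 _ h0, e]
      exact h t (h1 htT) htT 0 ⟨le_rfl, ht.1⟩ (Or.inl rfl)
    · have hs : t - σ ∈ Ioo 0 T := ⟨h0, (sub_lt_self t hσ).trans htT.2⟩
      rw [hJj _ hs, hint h0.le (sub_le_self t hσ.le) htT.2]
      exact h t (h1 htT) htT _ ⟨h0.le, sub_lt_self t hσ⟩ (Or.inr (h2 hs))
  rw [hJj b hbT, intervalIntegral.integral_of_le hbT.1.le,
    setIntegral_congr_fun (g := fun s ↦ ‖g s‖ ^ 2) measurableSet_Ioc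
      fun r hr ↦ by simp only [hEq le_rfl hbT.2 hr]] at this
  rwa [intervalIntegral.integral_of_le hbT.1.le]

end WeightedHeat

/-! ### The Hardy and Sobolev inequalities -/

namespace WeightedHeat

/-- The fundamental theorem of calculus along the ray from `x` to infinity. The ray is run backwards
so that the integral is over `Iic (-1)`. -/
theorem enorm_le_lintegral_fderiv_smul {E : Type*} [NormedAddCommGroup E] [NormedSpace ℝ E]
    {φ : E → ℝ} (hφ : ContDiff ℝ 1 φ) (hc : HasCompactSupport φ) {x : E} (hx : x ≠ 0) :
    ‖φ x‖ₑ ≤ (∫⁻ s in Ici (1 : ℝ), ‖fderiv ℝ φ (s • x)‖ₑ) * ‖x‖ₑ := by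
  set f : ℝ → ℝ := fun r ↦ φ ((-r) • x) with hf
  have hfc : ContDiff ℝ 1 f := hφ.comp (contDiff_neg.smul contDiff_const)
  have hemb : Topology.IsClosedEmbedding fun r : ℝ ↦ (-r) • x :=
    (isClosedEmbedding_smul_left hx).comp (Homeomorph.neg ℝ).isClosedEmbedding
  have h1 := HasCompactSupport.enorm_le_lintegral_Ici_deriv hfc
    (hc.comp_isClosedEmbedding hemb) (-1)
  have hd : ∀ r, ‖deriv f r‖ₑ ≤ ‖fderiv ℝ φ ((-r) • x)‖ₑ * ‖x‖ₑ := fun r ↦ by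
    have h2 : HasDerivAt (fun r : ℝ ↦ (-r) • x) ((-1 : ℝ) • x) r :=
      (hasDerivAt_neg r).smul_const x
    have h3 : HasDerivAt f (fderiv ℝ φ ((-r) • x) ((-1 : ℝ) • x)) r :=
      ((hφ.differentiable one_ne_zero _).hasFDerivAt).comp_hasDerivAt r h2
    rw [h3.deriv]
    refine (ContinuousLinearMap.le_opENorm _ _).trans ?_
    simp
  calc ‖φ x‖ₑ = ‖f (-1)‖ₑ := by simp [hf]
    _ ≤ ∫⁻ r in Iic (-1), ‖fderiv ℝ φ ((-r) • x)‖ₑ * ‖x‖ₑ := h1.trans (lintegral_mono hd)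
    _ = (∫⁻ r in Iic (-1), ‖fderiv ℝ φ ((-r) • x)‖ₑ) * ‖x‖ₑ :=
        lintegral_mul_const' _ _ (by simp)
    _ = _ := by
        congr 1
        have := (Measure.measurePreserving_neg (volume : Measure ℝ)).setLIntegral_comp_preimage_emb
          (Homeomorph.neg ℝ).measurableEmbedding (fun s ↦ ‖fderiv ℝ φ (s • x)‖ₑ) (Ici 1)
        simpa using this

/-- Cauchy–Schwarz for `F = s^(-3/4) · s^(3/4) F`. The weight is chosen so that `s^(-3/2)` is
integrable at infinity and, in dimension at least 3, `s^(3/2)` times the dilation factor `s^(-n)` is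
again at most `s^(-3/2)`. -/
theorem lintegral_Ici_sq_le {F : ℝ → ENNReal} (hF : Measurable F) :
    (∫⁻ s in Ici (1 : ℝ), F s) ^ 2 ≤ (∫⁻ s in Ici (1 : ℝ), ENNReal.ofReal (s ^ (-3 / 2 : ℝ))) *
      ∫⁻ s in Ici (1 : ℝ), ENNReal.ofReal (s ^ (3 / 2 : ℝ)) * F s ^ 2 := by
  have h := ENNReal.lintegral_mul_norm_pow_le (μ := volume.restrict (Ici (1 : ℝ)))
    (f := fun s ↦ ENNReal.ofReal (s ^ (-3 / 2 : ℝ)))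
    (g := fun s ↦ ENNReal.ofReal (s ^ (3 / 2 : ℝ)) * F s ^ 2)
    (by fun_prop) (by fun_prop) (p := 1 / 2) (q := 1 / 2) (by norm_num) (by norm_num)
    (by norm_num)
  have e : ∫⁻ s in Ici (1 : ℝ), ENNReal.ofReal (s ^ (-3 / 2 : ℝ)) ^ (1 / 2 : ℝ) *
      (ENNReal.ofReal (s ^ (3 / 2 : ℝ)) * F s ^ 2) ^ (1 / 2 : ℝ) = ∫⁻ s in Ici (1 : ℝ), F s := by
    refine setLIntegral_congr_fun measurableSet_Ici fun s hs ↦ ?_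
    have hs0 : 0 < s := one_pos.trans_le hs
    rw [← ENNReal.mul_rpow_of_nonneg _ _ (by norm_num), ← mul_assoc,
      ← ENNReal.ofReal_mul (by positivity), ← Real.rpow_add hs0]
    norm_num
    rw [← ENNReal.rpow_natCast, ← ENNReal.rpow_mul]
    norm_num
  rw [e] at h
  calc _ ≤ _ := pow_le_pow_left' h 2
    _ = _ := by
      rw [mul_pow, ← ENNReal.rpow_natCast, ← ENNReal.rpow_mul, ← ENNReal.rpow_natCast,
        ← ENNReal.rpow_mul]
      norm_num

theorem lintegral_Ici_rpow_lt_top :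
    ∫⁻ s in Ici (1 : ℝ), ENNReal.ofReal (s ^ (-3 / 2 : ℝ)) < ⊤ := by
  rw [setLIntegral_congr Ioi_ae_eq_Ici.symm]
  exact (integrableOn_Ioi_rpow_of_lt (show (-3 / 2 : ℝ) < -1 by norm_num) one_pos).lintegral_lt_top

theorem lintegral_comp_smul {E : Type*} [NormedAddCommGroup E] [NormedSpace ℝ E]
    [MeasurableSpace E] [BorelSpace E] [FiniteDimensional ℝ E] (μ : Measure E) [μ.IsAddHaarMeasure]
    (f : E → ENNReal) {s : ℝ} (hs : s ≠ 0) :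
    ∫⁻ x, f (s • x) ∂μ = ENNReal.ofReal |(s ^ Module.finrank ℝ E)⁻¹| * ∫⁻ x, f x ∂μ := by
  have := (Homeomorph.smulOfNeZero s hs : E ≃ₜ E).measurableEmbedding.lintegral_map (μ := μ) f
  rw [← smul_eq_mul, ← lintegral_smul_measure, ← Measure.map_addHaar_smul μ hs]
  exact this.symm

/-- Hardy's inequality in dimension at least `3`. -/
theorem exists_hardy {E : Type*} [NormedAddCommGroup E] [NormedSpace ℝ E]
    [MeasurableSpace E] [BorelSpace E] [FiniteDimensional ℝ E] (μ : Measure E) [μ.IsAddHaarMeasure]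
    (hn : 3 ≤ Module.finrank ℝ E) :
    ∃ C : ℝ≥0, ∀ φ : E → ℝ, ContDiff ℝ 1 φ → HasCompactSupport φ →
      ∫⁻ x, ENNReal.ofReal ((‖x‖ ^ 2)⁻¹) * ‖φ x‖ₑ ^ 2 ∂μ ≤
        C ^ 2 * ∫⁻ x, ‖fderiv ℝ φ x‖ₑ ^ 2 ∂μ := by
  set K := ∫⁻ s in Ici (1 : ℝ), ENNReal.ofReal (s ^ (-3 / 2 : ℝ)) with hK
  have hKt : K ≠ ⊤ := lintegral_Ici_rpow_lt_top.ne
  refine ⟨K.toNNReal, fun φ hφ hc ↦ ?_⟩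
  rw [ENNReal.coe_toNNReal hKt]
  have hcont : Continuous (fderiv ℝ φ) := hφ.continuous_fderiv one_ne_zero
  have hpt : ∀ x, ENNReal.ofReal ((‖x‖ ^ 2)⁻¹) * ‖φ x‖ₑ ^ 2 ≤
      K * ∫⁻ s in Ici (1 : ℝ), ENNReal.ofReal (s ^ (3 / 2 : ℝ)) * ‖fderiv ℝ φ (s • x)‖ₑ ^ 2 := by
    intro x
    rcases eq_or_ne x 0 with rfl | hx
    · simp
    have h1 := enorm_le_lintegral_fderiv_smul hφ hc hx
    have h2 := lintegral_Ici_sq_le (F := fun s ↦ ‖fderiv ℝ φ (s • x)‖ₑ) (by fun_prop)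
    have hxn : 0 < ‖x‖ := norm_pos_iff.2 hx
    have e : ENNReal.ofReal ((‖x‖ ^ 2)⁻¹) * ‖x‖ₑ ^ 2 = 1 := by
      rw [← ofReal_norm, ← ENNReal.ofReal_pow hxn.le, ← ENNReal.ofReal_mul (by positivity),
        inv_mul_cancel₀ (by positivity), ENNReal.ofReal_one]
    calc _ ≤ ENNReal.ofReal ((‖x‖ ^ 2)⁻¹) *
          ((∫⁻ s in Ici (1 : ℝ), ‖fderiv ℝ φ (s • x)‖ₑ) * ‖x‖ₑ) ^ 2 := by gcongr
      _ = (ENNReal.ofReal ((‖x‖ ^ 2)⁻¹) * ‖x‖ₑ ^ 2) *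
          (∫⁻ s in Ici (1 : ℝ), ‖fderiv ℝ φ (s • x)‖ₑ) ^ 2 := by ring
      _ ≤ _ := by rw [e, one_mul]; exact h2
  calc _ ≤ ∫⁻ x, (K * ∫⁻ s in Ici (1 : ℝ),
        ENNReal.ofReal (s ^ (3 / 2 : ℝ)) * ‖fderiv ℝ φ (s • x)‖ₑ ^ 2) ∂μ := lintegral_mono hpt
    _ = K * ∫⁻ s in Ici (1 : ℝ), ∫⁻ x,
        ENNReal.ofReal (s ^ (3 / 2 : ℝ)) * ‖fderiv ℝ φ (s • x)‖ₑ ^ 2 ∂μ := by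
        rw [lintegral_const_mul' _ _ hKt, lintegral_lintegral_swap]
        refine Measurable.aemeasurable ?_
        have : Continuous fun z : E × ℝ ↦ fderiv ℝ φ (z.2 • z.1) :=
          hcont.comp (continuous_snd.smul continuous_fst)
        have h2 : Measurable fun z : E × ℝ ↦ ‖fderiv ℝ φ (z.2 • z.1)‖ₑ := this.enorm.measurable
        exact Measurable.mul (by fun_prop) (h2.pow_const 2)
    _ ≤ K * ∫⁻ s in Ici (1 : ℝ), (ENNReal.ofReal (s ^ (-3 / 2 : ℝ)) *
        ∫⁻ x, ‖fderiv ℝ φ x‖ₑ ^ 2 ∂μ) := by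
        refine mul_le_mul_right ?_ K
        refine setLIntegral_mono' measurableSet_Ici fun s hs ↦ ?_
        have hs1 : 1 ≤ s := hs
        have hs0 : 0 < s := one_pos.trans_le hs
        rw [lintegral_const_mul' _ _ (by simp),
          lintegral_comp_smul μ (fun x ↦ ‖fderiv ℝ φ x‖ₑ ^ 2) hs0.ne', ← mul_assoc,
          ← ENNReal.ofReal_mul (by positivity)]
        gcongr
        rw [abs_of_pos (by positivity), ← Real.rpow_natCast, ← Real.rpow_neg hs0.le,
          ← Real.rpow_add hs0]
        refine Real.rpow_le_rpow_of_exponent_le hs1 ?_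
        have : (3 : ℝ) ≤ Module.finrank ℝ E := by exact_mod_cast hn
        linarith
    _ = _ := by
        rw [lintegral_mul_const _ (by fun_prop), ← hK, ← mul_assoc, sq]

variable {n : ℕ} {Ω : Set (EuclideanSpace ℝ (Fin n))}

/-- An inequality between a norm of a test function and the norm of its gradient extends
to `H₀¹(Ω)`. -/
theorem H01.eLpNorm_fn_le {ν : Measure (EuclideanSpace ℝ (Fin n))} (hν : ν ≪ volume.restrict Ω)
    {q : ENNReal} {C : ℝ≥0}
    (h : ∀ φ : EuclideanSpace ℝ (Fin n) → ℝ, ContDiff ℝ ∞ φ → HasCompactSupport φ →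
      tsupport φ ⊆ Ω → eLpNorm φ q ν ≤ C * eLpNorm (gradient φ) 2 (volume.restrict Ω))
    (v : H01 Ω) : eLpNorm v.fn q ν ≤ C * eLpNorm v.grad 2 (volume.restrict Ω) := by
  obtain ⟨w, hw, hlim⟩ := mem_closure_iff_seq_limit.1 v.2
  have h1 : Tendsto (fun k ↦ (w k).1) atTop (𝓝 v.1.1) := (continuous_fst.tendsto _).comp hlim
  have h2 : Tendsto (fun k ↦ (w k).2) atTop (𝓝 v.1.2) := (continuous_snd.tendsto _).comp hlim
  -- Almost everywhere convergence passes to any `ν ≪ volume.restrict Ω`, where the norm is lower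
  -- semicontinuous; no convergence in the target norm is needed.
  obtain ⟨ns, hns, hae⟩ := (tendstoInMeasure_of_tendsto_Lp h1).exists_seq_tendsto_ae
  have hb : ∀ k, eLpNorm (w k).1 q ν ≤ C * ‖(w k).2‖ₑ := fun k ↦ by
    obtain ⟨φ, a1, a2, a3, a4, a5⟩ := hw k
    rw [eLpNorm_congr_ae (hν.ae_eq a4), Lp.enorm_def, eLpNorm_congr_ae a5]
    exact h φ a1 a2 a3
  have hmeas : ∀ k, AEStronglyMeasurable (w (ns k)).1 ν := fun k ↦
    (Lp.aestronglyMeasurable _).mono_ac hν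
  have h3 := Lp.eLpNorm_lim_le_liminf_eLpNorm (p := q) hmeas v.fn (hν.ae_le hae)
  have h4 : Tendsto (fun k ↦ (C : ENNReal) * ‖(w (ns k)).2‖ₑ) atTop (𝓝 (C * ‖v.1.2‖ₑ)) :=
    ENNReal.Tendsto.const_mul ((continuous_enorm.tendsto _).comp (h2.comp hns.tendsto_atTop))
      (Or.inr (by simp))
  calc _ ≤ _ := h3
    _ ≤ liminf (fun k ↦ (C : ENNReal) * ‖(w (ns k)).2‖ₑ) atTop :=
      liminf_le_liminf (.of_forall fun k ↦ hb _)
    _ = _ := by rw [h4.liminf_eq, Lp.enorm_def]; rfl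

theorem norm_gradient (φ : EuclideanSpace ℝ (Fin n) → ℝ) (x : EuclideanSpace ℝ (Fin n)) :
    ‖gradient φ x‖ = ‖fderiv ℝ φ x‖ := by
  simp [gradient]

/-- Test functions extend by zero, so whole-space inequalities apply and the regularity of the
boundary plays no role. -/
theorem eLpNorm_fderiv_eq {φ : EuclideanSpace ℝ (Fin n) → ℝ}
    (hφ : tsupport φ ⊆ Ω) :
    eLpNorm (fderiv ℝ φ) 2 volume = eLpNorm (gradient φ) 2 (volume.restrict Ω) := by
  have h1 : Function.support (fderiv ℝ φ) ⊆ Ω := (support_fderiv_subset ℝ).trans hφ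
  rw [← eLpNorm_restrict_eq_of_support_subset (f := fderiv ℝ φ) h1]
  exact eLpNorm_congr_norm_ae (.of_forall fun x ↦ (norm_gradient φ x).symm)

/-- The critical Sobolev exponent `2n/(n-2)`. -/
noncomputable def criticalExponent (n : ℕ) : ℝ := 2 * n / (n - 2)

theorem two_lt_criticalExponent (hn : 3 ≤ n) : 2 < criticalExponent n := by
  have : (3 : ℝ) ≤ n := by exact_mod_cast hn
  rw [criticalExponent, lt_div_iff₀ (by linarith)]
  linarith

theorem H01.exists_eLpNorm_criticalExponent_le (hn : 3 ≤ n) :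
    ∃ C : ℝ≥0, ∀ v : H01 Ω, eLpNorm v.fn (ENNReal.ofReal (criticalExponent n))
      (volume.restrict Ω) ≤ C * eLpNorm v.grad 2 (volume.restrict Ω) := by
  refine ⟨SNormLESNormFDerivOfEqConst ℝ (volume : Measure (EuclideanSpace ℝ (Fin n))) 2,
    H01.eLpNorm_fn_le Measure.AbsolutelyContinuous.rfl fun φ h1 h2 h3 ↦ ?_⟩
  rw [← eLpNorm_fderiv_eq h3]
  refine (eLpNorm_mono_measure _ Measure.restrict_le_self).trans ?_
  have hn' : (3 : ℝ) ≤ n := by exact_mod_cast hn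
  refine eLpNorm_le_eLpNorm_fderiv_of_eq volume (h1.of_le (by simp)) h2 (p := 2)
    (by norm_num) (by simp; lia) ?_
  rw [Real.coe_toNNReal _ (zero_lt_two.trans (two_lt_criticalExponent hn)).le, criticalExponent]
  simp only [finrank_euclideanSpace, Fintype.card_fin]
  have : (n : ℝ) - 2 ≠ 0 := by linarith
  push_cast
  field_simp

theorem weightedMeasure_absolutelyContinuous : weightedMeasure Ω ≪ volume.restrict Ω :=
  withDensity_absolutelyContinuous _ _

theorem H01.exists_eLpNorm_weightedMeasure_le (hn : 3 ≤ n) :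
    ∃ C : ℝ≥0, ∀ v : H01 Ω, eLpNorm v.fn 2 (weightedMeasure Ω) ≤
      C * eLpNorm v.grad 2 (volume.restrict Ω) := by
  obtain ⟨C, hC⟩ := exists_hardy (volume : Measure (EuclideanSpace ℝ (Fin n))) (by simpa using hn)
  refine ⟨C, H01.eLpNorm_fn_le weightedMeasure_absolutelyContinuous fun φ h1 h2 h3 ↦ ?_⟩
  rw [← eLpNorm_fderiv_eq h3, ← ENNReal.pow_le_pow_left_iff two_ne_zero, mul_pow]
  have e : ∀ {F : Type} [NormedAddCommGroup F] (f : EuclideanSpace ℝ (Fin n) → F)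
      (μ : Measure (EuclideanSpace ℝ (Fin n))), eLpNorm f 2 μ ^ 2 = ∫⁻ x, ‖f x‖ₑ ^ 2 ∂μ := by
    intro F _ f μ
    simpa using eLpNorm_nnreal_pow_eq_lintegral (f := f) (μ := μ) (p := 2) two_ne_zero
  rw [e, e]
  refine le_trans ?_ (hC φ (h1.of_le (by simp)) h2)
  rw [weightedMeasure, lintegral_withDensity_eq_lintegral_mul _ (by fun_prop)
    (by have := h1.continuous; fun_prop)]
  exact lintegral_mono' Measure.restrict_le_self le_rfl

end WeightedHeat

namespace WeightedHeat

variable {n : ℕ} {Ω : Set (EuclideanSpace ℝ (Fin n))}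

/-! ### Elementary inequalities -/

/-- Bernoulli's inequality with exponent `r + 1` at `B / A`. The factor `B` on the left compensates
for the singular derivative of the power when `r < 1`. -/
theorem rpow_sub_rpow_mul_le {r A B : ℝ} (hr : 0 < r) (hB : 0 ≤ B) (hBA : B ≤ A) :
    (A ^ r - B ^ r) * B ≤ r * (A ^ r * (A - B)) := by
  rcases hB.eq_or_lt with rfl | hB0
  · have : 0 ≤ A ^ r := Real.rpow_nonneg hBA r
    simp only [mul_zero, sub_zero]; positivity
  have hA : 0 < A := hB0.trans_le hBA
  have h1 := one_add_mul_self_le_rpow_one_add (s := B / A - 1)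
    (by have := div_nonneg hB hA.le; linarith) (p := r + 1) (by linarith)
  rw [add_sub_cancel, Real.rpow_add_one (by positivity), Real.div_rpow hB hA.le] at h1
  have hAr : 0 < A ^ r := Real.rpow_pos_of_pos hA r
  have h2 := mul_le_mul_of_nonneg_left h1 (mul_pos hAr hA).le
  have e1 : A ^ r * A * (1 + (r + 1) * (B / A - 1)) = A ^ r * (A + (r + 1) * (B - A)) := by
    field_simp
  have e2 : A ^ r * A * (B ^ r / A ^ r * (B / A)) = B ^ r * B := by field_simp
  rw [e1, e2] at h2
  linarith

/-- A quantitative form of the monotonicity and local Lipschitz continuity of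
`a ↦ |a|^(p-1) a`. -/
theorem abs_rpow_mul_sub_mul_sub_le {p : ℝ} (hp : 1 < p) (a b : ℝ) :
    (|a| ^ (p - 1) * a - |b| ^ (p - 1) * b) * (a - b) ≤
      p * ((|a| ^ (p - 1) + |b| ^ (p - 1)) * (a - b) ^ 2) := by
  have key : ∀ a b : ℝ, |b| ≤ |a| → (|a| ^ (p - 1) * a - |b| ^ (p - 1) * b) * (a - b) ≤
      p * ((|a| ^ (p - 1) + |b| ^ (p - 1)) * (a - b) ^ 2) := by
    intro a b hab
    have h1 := rpow_sub_rpow_mul_le (sub_pos.2 hp) (abs_nonneg b) hab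
    have hA : 0 ≤ |a| ^ (p - 1) := Real.rpow_nonneg (abs_nonneg _) _
    have hB : 0 ≤ |b| ^ (p - 1) := Real.rpow_nonneg (abs_nonneg _) _
    have hAB : |b| ^ (p - 1) ≤ |a| ^ (p - 1) :=
      Real.rpow_le_rpow (abs_nonneg _) hab (by linarith)
    have h2 : |a| - |b| ≤ |a - b| := abs_sub_abs_le_abs_sub a b
    have h3 : (|a| ^ (p - 1) - |b| ^ (p - 1)) * b * (a - b) ≤
        (p - 1) * (|a| ^ (p - 1) * |a - b|) * |a - b| := by
      calc _ ≤ |(|a| ^ (p - 1) - |b| ^ (p - 1)) * b * (a - b)| := le_abs_self _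
        _ = (|a| ^ (p - 1) - |b| ^ (p - 1)) * |b| * |a - b| := by
          rw [abs_mul, abs_mul, abs_of_nonneg (sub_nonneg.2 hAB)]
        _ ≤ ((p - 1) * (|a| ^ (p - 1) * (|a| - |b|))) * |a - b| := by gcongr
        _ ≤ _ := by
          have : 0 ≤ p - 1 := by linarith
          gcongr
    have h4 : |a - b| * |a - b| = (a - b) ^ 2 := by rw [← sq, sq_abs]
    have h5 : 0 ≤ p * (|b| ^ (p - 1) * (a - b) ^ 2) := by positivity
    have h6 : (p - 1) * (|a| ^ (p - 1) * |a - b|) * |a - b| =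
      (p - 1) * |a| ^ (p - 1) * (a - b) ^ 2 := by rw [← h4]; ring
    nlinarith
  rcases le_total |b| |a| with h | h
  · exact key a b h
  · have := key b a h
    nlinarith

theorem abs_rpow_add_one {p : ℝ} (hp : 1 < p) (a : ℝ) : |a| ^ (p - 1) * a * a = |a| ^ (p + 1) := by
  rcases eq_or_ne a 0 with rfl | ha
  · simp [Real.zero_rpow (by linarith : p + 1 ≠ 0)]
  · have h : 0 < |a| := abs_pos.2 ha
    rw [mul_assoc, ← abs_mul_abs_self a, ← mul_assoc, ← Real.rpow_add_one h.ne',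
      ← Real.rpow_add_one h.ne']
    ring_nf

theorem abs_rpow_mul_sq_le {p : ℝ} (hp : 1 < p) (a b : ℝ) :
    |a| ^ (p - 1) * b ^ 2 ≤ |a| ^ (p + 1) + |b| ^ (p + 1) := by
  have hA : 0 ≤ |a| ^ (p + 1) := Real.rpow_nonneg (abs_nonneg _) _
  have hB : 0 ≤ |b| ^ (p + 1) := Real.rpow_nonneg (abs_nonneg _) _
  have h1 : 0 ≤ |a| ^ (p - 1) := Real.rpow_nonneg (abs_nonneg _) _
  have hp1 : 0 ≤ p - 1 := by linarith
  rcases le_total |b| |a| with h | h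
  · have : b ^ 2 ≤ a ^ 2 := sq_le_sq.2 h
    calc _ ≤ |a| ^ (p - 1) * a ^ 2 := by gcongr
      _ = |a| ^ (p + 1) := by rw [← abs_rpow_add_one hp]; ring
      _ ≤ _ := by linarith
  · calc _ ≤ |b| ^ (p - 1) * b ^ 2 := by gcongr
      _ = |b| ^ (p + 1) := by rw [← abs_rpow_add_one hp]; ring
      _ ≤ _ := by linarith

/-- The tangent line of `|a|^(p+1)/(p+1)` up to a quadratic error. -/
theorem abs_rpow_tangent_le {p : ℝ} (hp : 1 < p) (a b : ℝ) :
    |a| ^ (p - 1) * a * (a - b) - p * (|a| ^ (p - 1) * (a - b) ^ 2 + |b| ^ (p - 1) * (a - b) ^ 2) ≤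
      1 / (p + 1) * |a| ^ (p + 1) - 1 / (p + 1) * |b| ^ (p + 1) := by
  have h1 := abs_rpow_mul_sub_mul_sub_le hp a b
  have hp0 : 0 < p := by linarith
  have hconj : ((p + 1) / p).HolderConjugate (p + 1) := by
    rw [Real.holderConjugate_iff]
    constructor
    · rw [one_lt_div hp0]; linarith
    · field_simp
  -- Young's inequality is the tangent line inequality at `b`; `h1` pays for replacing the slope at
  -- `b` by the slope at `a`.
  have h2 := Real.young_inequality_of_nonneg (Real.rpow_nonneg (abs_nonneg b) p) (abs_nonneg a)
    hconj
  rw [← Real.rpow_mul (abs_nonneg b), mul_div_cancel₀ _ hp0.ne'] at h2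
  have h3 : |b| ^ (p - 1) * b * a ≤ |b| ^ p * |a| := by
    refine (le_abs_self _).trans_eq ?_
    rw [abs_mul, abs_mul, abs_of_nonneg (Real.rpow_nonneg (abs_nonneg _) _)]
    rcases eq_or_ne b 0 with rfl | hb
    · simp [Real.zero_rpow hp0.ne']
    · rw [← Real.rpow_add_one (abs_pos.2 hb).ne', sub_add_cancel]
  have h4 := abs_rpow_add_one hp b
  have h5 : |b| ^ (p + 1) / ((p + 1) / p) = |b| ^ (p + 1) - 1 / (p + 1) * |b| ^ (p + 1) := by
    field_simp; ring
  rw [h5] at h2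
  have h6 : |a| ^ (p + 1) / (p + 1) = 1 / (p + 1) * |a| ^ (p + 1) := by ring
  rw [h6] at h2
  nlinarith

/-- For large `a` the quotient `a^(r-s)` is below `δ`. This is how strict subcriticality produces a
small constant. -/
theorem exists_rpow_le_mul_rpow_add {r s δ : ℝ} (hr : 0 < r) (hrs : r < s) (hδ : 0 < δ) :
    ∃ C : ℝ, 0 ≤ C ∧ ∀ a, 0 ≤ a → a ^ r ≤ δ * a ^ s + C := by
  obtain ⟨A, hA⟩ := eventually_atTop.1
    ((tendsto_rpow_neg_atTop (sub_pos.2 hrs)).eventually_le_const hδ)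
  refine ⟨(max A 1) ^ r, by positivity, fun a ha ↦ ?_⟩
  rcases le_total a (max A 1) with h | h
  · have := Real.rpow_le_rpow ha h hr.le
    have h2 : 0 ≤ a ^ s := Real.rpow_nonneg ha s
    nlinarith
  · have ha0 : 0 < a := one_pos.trans_le ((le_max_right A 1).trans h)
    have h1 := hA a ((le_max_left A 1).trans h)
    have e : a ^ r = a ^ (-(s - r)) * a ^ s := by
      rw [← Real.rpow_add ha0]; ring_nf
    rw [e]
    have : 0 ≤ (max A 1) ^ r := by positivity
    have h2 : 0 ≤ a ^ s := Real.rpow_nonneg ha s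
    nlinarith

/-! ### Embeddings of `H₀¹(Ω)` -/

namespace H01

theorem aestronglyMeasurable_fn (v : H01 Ω) : AEStronglyMeasurable v.fn (volume.restrict Ω) :=
  Lp.aestronglyMeasurable _

theorem fn_add (v w : H01 Ω) : (v + w).fn =ᵐ[volume.restrict Ω] v.fn + w.fn :=
  Lp.coeFn_add v.1.1 w.1.1

theorem fn_sub (v w : H01 Ω) : (v - w).fn =ᵐ[volume.restrict Ω] v.fn - w.fn :=
  Lp.coeFn_sub v.1.1 w.1.1

theorem fn_smul (c : ℝ) (v : H01 Ω) : (c • v).fn =ᵐ[volume.restrict Ω] c • v.fn :=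
  Lp.coeFn_smul c v.1.1

theorem eLpNorm_grad (v : H01 Ω) : eLpNorm v.grad 2 (volume.restrict Ω) = ‖v.1.2‖ₑ := by
  rw [Lp.enorm_def]; rfl

theorem integral_norm_grad_sq (v : H01 Ω) : ∫ x in Ω, ‖v.grad x‖ ^ 2 = ‖v.1.2‖ ^ 2 := by
  have := real_inner_self_eq_norm_sq v.1.2
  rw [L2.inner_def] at this
  simp only [real_inner_self_eq_norm_sq] at this
  exact this

theorem norm_snd_le (v : H01 Ω) : ‖v.1.2‖ ≤ ‖v‖ := _root_.norm_snd_le v.1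

/-- A bound of a norm of `v` by the norm of `∇v` gives a continuous embedding. -/
theorem exists_embedding {ν : Measure (EuclideanSpace ℝ (Fin n))} (hν : ν ≪ volume.restrict Ω)
    {q : ENNReal} [Fact (1 ≤ q)] {C : ℝ≥0}
    (h : ∀ v : H01 Ω, eLpNorm v.fn q ν ≤ C * eLpNorm v.grad 2 (volume.restrict Ω)) :
    ∃ Λ : H01 Ω →L[ℝ] Lp ℝ q ν, ∀ v, Λ v =ᵐ[ν] v.fn := by
  have hm : ∀ v : H01 Ω, MemLp v.fn q ν := fun v ↦
    ⟨(aestronglyMeasurable_fn v).mono_ac hν, (h v).trans_lt (by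
      rw [eLpNorm_grad]; exact ENNReal.mul_lt_top (by simp) (by simp))⟩
  let Λ : H01 Ω →ₗ[ℝ] Lp ℝ q ν :=
    { toFun := fun v ↦ (hm v).toLp v.fn
      map_add' := fun v w ↦ by
        rw [← MemLp.toLp_add]
        exact MemLp.toLp_congr _ _ (hν.ae_eq (fn_add v w))
      map_smul' := fun c v ↦ by
        rw [RingHom.id_apply, ← MemLp.toLp_const_smul]
        exact MemLp.toLp_congr _ _ (hν.ae_eq (fn_smul c v)) }
  refine ⟨Λ.mkContinuous C fun v ↦ ?_, fun v ↦ (hm v).coeFn_toLp⟩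
  have h1 : ‖Λ v‖ₑ ≤ C * ‖v.1.2‖ₑ := by
    rw [Lp.enorm_def, ← eLpNorm_grad]
    exact (eLpNorm_congr_ae (hm v).coeFn_toLp).trans_le (h v)
  have h2 : ‖Λ v‖ ≤ C * ‖v.1.2‖ := by
    have := ENNReal.toReal_mono (by finiteness) h1
    simpa using this
  exact h2.trans (by gcongr; exact norm_snd_le v)

end H01

theorem exists_weighted_embedding (hn : 3 ≤ n) :
    ∃ Λ : H01 Ω →L[ℝ] Lp ℝ 2 (weightedMeasure Ω), ∀ v, Λ v =ᵐ[weightedMeasure Ω] v.fn := by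
  obtain ⟨C, hC⟩ := H01.exists_eLpNorm_weightedMeasure_le (Ω := Ω) hn
  exact H01.exists_embedding weightedMeasure_absolutelyContinuous hC

theorem exists_power_embedding (hn : 3 ≤ n) (hΩb : Bornology.IsBounded Ω) {q : ℝ} (hq : 1 ≤ q)
    (hqn : q ≤ criticalExponent n) : haveI : Fact (1 ≤ ENNReal.ofReal q) := ⟨by simpa using hq⟩
    ∃ Λ : H01 Ω →L[ℝ] Lp ℝ (ENNReal.ofReal q) (volume.restrict Ω),
      ∀ v, Λ v =ᵐ[volume.restrict Ω] v.fn := by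
  have : Fact (1 ≤ ENNReal.ofReal q) := ⟨by simpa using hq⟩
  have : IsFiniteMeasure (volume.restrict Ω) := ⟨by
    rw [Measure.restrict_apply_univ]; exact hΩb.measure_lt_top⟩
  obtain ⟨C, hC⟩ := H01.exists_eLpNorm_criticalExponent_le (Ω := Ω) hn
  set c : ENNReal := volume.restrict Ω univ ^ (1 / (ENNReal.ofReal q).toReal -
    1 / (ENNReal.ofReal (criticalExponent n)).toReal) with hc
  have hct : c ≠ ⊤ := by
    refine ENNReal.rpow_ne_top_of_nonneg ?_ (measure_ne_top _ _)
    rw [ENNReal.toReal_ofReal (by linarith), ENNReal.toReal_ofReal (by linarith), sub_nonneg]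
    exact one_div_le_one_div_of_le (by linarith) hqn
  refine H01.exists_embedding Measure.AbsolutelyContinuous.rfl (C := C * c.toNNReal) fun v ↦ ?_
  refine (eLpNorm_le_eLpNorm_mul_rpow_measure_univ (ENNReal.ofReal_le_ofReal hqn)
    v.aestronglyMeasurable_fn).trans ?_
  rw [ENNReal.coe_mul, ENNReal.coe_toNNReal hct, mul_right_comm]
  exact mul_le_mul_left (hC v) _

theorem integrable_abs_rpow (hn : 3 ≤ n) (hΩb : Bornology.IsBounded Ω) {q : ℝ} (hq : 1 ≤ q)
    (hqn : q ≤ criticalExponent n) (v : H01 Ω) :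
    Integrable (fun x ↦ |v.fn x| ^ q) (volume.restrict Ω) := by
  obtain ⟨Λ, hΛ⟩ := exists_power_embedding (Ω := Ω) hn hΩb hq hqn
  have := ((memLp_congr_ae (hΛ v)).1 (Lp.memLp _)).integrable_norm_rpow (by simpa using by linarith)
    (by simp)
  simpa [ENNReal.toReal_ofReal (by linarith : 0 ≤ q)] using this

theorem exists_integral_abs_rpow_le (hn : 3 ≤ n) (hΩb : Bornology.IsBounded Ω) {q : ℝ}
    (hq : 1 ≤ q) (hqn : q ≤ criticalExponent n) :
    ∃ C : ℝ, (∀ v : H01 Ω, ∫ x in Ω, |v.fn x| ^ q ≤ (C * ‖v‖) ^ q) ∧ 0 ≤ C ∧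
      Continuous fun v : H01 Ω ↦ ∫ x in Ω, |v.fn x| ^ q := by
  have : Fact (1 ≤ ENNReal.ofReal q) := ⟨by simpa using hq⟩
  obtain ⟨Λ, hΛ⟩ := exists_power_embedding (Ω := Ω) hn hΩb hq hqn
  have hq0 : 0 < q := by linarith
  have h : ∀ v : H01 Ω, ∫ x in Ω, |v.fn x| ^ q = ‖Λ v‖ ^ q := fun v ↦ by
    have h0 : 0 ≤ ∫ x in Ω, |v.fn x| ^ q := integral_nonneg fun x ↦ by positivity
    rw [Lp.norm_def, eLpNorm_congr_ae (hΛ v), MemLp.eLpNorm_eq_integral_rpow_norm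
      (by simpa using hq0) (by simp) ((memLp_congr_ae (hΛ v)).1 (Lp.memLp _)),
      ENNReal.toReal_ofReal hq0.le]
    simp only [Real.norm_eq_abs]
    rw [ENNReal.toReal_ofReal (by positivity), Real.rpow_inv_rpow h0 hq0.ne']
  refine ⟨‖Λ‖, fun v ↦ ?_, Λ.opNorm_nonneg, ?_⟩
  · rw [h]
    exact Real.rpow_le_rpow (norm_nonneg _) (Λ.le_opNorm v) hq0.le
  · simp only [h]
    exact Λ.continuous.norm.rpow_const fun _ ↦ Or.inr hq0.le

end WeightedHeat

namespace WeightedHeat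

variable {n : ℕ} {Ω : Set (EuclideanSpace ℝ (Fin n))}

/-! ### The weighted space -/

theorem integral_weightedMeasure (f : EuclideanSpace ℝ (Fin n) → ℝ) :
    ∫ x, f x ∂weightedMeasure Ω = ∫ x in Ω, f x / ‖x‖ ^ 2 := by
  rw [weightedMeasure, integral_withDensity_eq_integral_toReal_smul (by fun_prop) (by simp)]
  refine integral_congr_ae (.of_forall fun x ↦ ?_)
  simp only [smul_eq_mul]
  rw [ENNReal.toReal_ofReal (by positivity)]
  ring

theorem volume_absolutelyContinuous_weightedMeasure (hn : n ≠ 0) :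
    volume.restrict Ω ≪ weightedMeasure Ω := by
  have : Nonempty (Fin n) := ⟨⟨0, Nat.pos_of_ne_zero hn⟩⟩
  refine withDensity_absolutelyContinuous' (by fun_prop) ?_
  filter_upwards [ae_restrict_of_ae (Measure.ae_ne volume 0)] with x hx
  have : 0 < ‖x‖ := norm_pos_iff.2 hx
  simpa using this.ne'

section embedding

variable {Λ : H01 Ω →L[ℝ] Lp ℝ 2 (weightedMeasure Ω)}

theorem inner_embedding (hΛ : ∀ v, Λ v =ᵐ[weightedMeasure Ω] v.fn)
    (f : Lp ℝ 2 (weightedMeasure Ω)) (v : H01 Ω) :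
    inner ℝ f (Λ v) = ∫ x in Ω, f x * v.fn x / ‖x‖ ^ 2 := by
  rw [L2.inner_def, ← integral_weightedMeasure]
  refine integral_congr_ae ?_
  filter_upwards [hΛ v] with x hx
  rw [hx]
  simp [mul_comm]

theorem weightedNormSq_eq (hΛ : ∀ v, Λ v =ᵐ[weightedMeasure Ω] v.fn) (v : H01 Ω) :
    weightedNormSq v = ‖Λ v‖ ^ 2 := by
  rw [← real_inner_self_eq_norm_sq, inner_embedding hΛ, weightedNormSq, ← integral_weightedMeasure,
    ← integral_weightedMeasure]
  refine integral_congr_ae ?_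
  filter_upwards [hΛ v] with x hx
  rw [hx, sq]

theorem integrable_sq_div (hΛ : ∀ v, Λ v =ᵐ[weightedMeasure Ω] v.fn) (v : H01 Ω) :
    Integrable (fun x ↦ (v.fn x) ^ 2 / ‖x‖ ^ 2) (volume.restrict Ω) := by
  have h : Integrable (fun x ↦ (v.fn x) ^ 2) (weightedMeasure Ω) :=
    ((memLp_congr_ae (hΛ v)).1 (Lp.memLp _)).integrable_sq
  rw [weightedMeasure, integrable_withDensity_iff_integrable_smul' (by fun_prop) (by simp)] at h
  refine h.congr (.of_forall fun x ↦ ?_)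
  simp only [smul_eq_mul]
  rw [ENNReal.toReal_ofReal (by positivity)]
  ring

theorem integral_sq_le (hn : n ≠ 0) (hΛ : ∀ v, Λ v =ᵐ[weightedMeasure Ω] v.fn)
    (hΩ : MeasurableSet Ω) {R : ℝ} (hR : ∀ x ∈ Ω, ‖x‖ ≤ R) (v : H01 Ω) :
    ∫ x in Ω, (v.fn x) ^ 2 ≤ R ^ 2 * weightedNormSq v := by
  have : Nonempty (Fin n) := ⟨⟨0, Nat.pos_of_ne_zero hn⟩⟩
  rw [weightedNormSq, ← integral_const_mul]
  refine integral_mono_of_nonneg (.of_forall fun x ↦ sq_nonneg _)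
    ((integrable_sq_div hΛ v).const_mul _) ?_
  filter_upwards [ae_restrict_of_ae (Measure.ae_ne volume 0), ae_restrict_mem hΩ] with x hx hxΩ
  have h0 : 0 < ‖x‖ := norm_pos_iff.2 hx
  have h1 : ‖x‖ ^ 2 ≤ R ^ 2 := pow_le_pow_left₀ h0.le (hR x hxΩ) 2
  rw [mul_div_assoc', le_div_iff₀ (by positivity), mul_comm]
  gcongr

end embedding

/-! ### Semiconvexity of the energy -/

theorem H01.norm_sq_le (v : H01 Ω) : ‖v‖ ^ 2 ≤ ‖v.1.2‖ ^ 2 + ∫ x in Ω, (v.fn x) ^ 2 := by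
  have h1 : ∫ x in Ω, (v.fn x) ^ 2 = ‖v.1.1‖ ^ 2 := by
    have := real_inner_self_eq_norm_sq v.1.1
    rw [L2.inner_def] at this
    simp only [real_inner_self_eq_norm_sq, Real.norm_eq_abs, sq_abs] at this
    exact this
  have h2 : ‖v‖ = max ‖v.1.1‖ ‖v.1.2‖ := rfl
  rw [h1, h2]
  rcases max_choice ‖v.1.1‖ ‖v.1.2‖ with h | h <;> rw [h] <;>
    nlinarith [sq_nonneg ‖v.1.1‖, sq_nonneg ‖v.1.2‖]

theorem integrable_abs_rpow_mul_sq {p : ℝ} (hp : 1 < p) {v w : H01 Ω}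
    (hv : Integrable (fun x ↦ |v.fn x| ^ (p + 1)) (volume.restrict Ω))
    (hw : Integrable (fun x ↦ |w.fn x| ^ (p + 1)) (volume.restrict Ω)) :
    Integrable (fun x ↦ |v.fn x| ^ (p - 1) * w.fn x ^ 2) (volume.restrict Ω) := by
  refine (hv.add hw).mono' ?_ (.of_forall fun x ↦ ?_)
  · have h1 := v.aestronglyMeasurable_fn.aemeasurable
    have h2 := w.aestronglyMeasurable_fn.aemeasurable
    exact AEMeasurable.aestronglyMeasurable (by fun_prop)
  · rw [Real.norm_of_nonneg (by positivity)]
    exact abs_rpow_mul_sq_le hp _ _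

theorem integrable_abs_rpow_mul_mul {p : ℝ} (hp : 1 < p) {v w : H01 Ω}
    (hv : Integrable (fun x ↦ |v.fn x| ^ (p + 1)) (volume.restrict Ω))
    (hw : Integrable (fun x ↦ |w.fn x| ^ (p + 1)) (volume.restrict Ω)) :
    Integrable (fun x ↦ |v.fn x| ^ (p - 1) * v.fn x * w.fn x) (volume.restrict Ω) := by
  refine (hv.add (integrable_abs_rpow_mul_sq hp hv hw)).mono' ?_ (.of_forall fun x ↦ ?_)
  · have h1 := v.aestronglyMeasurable_fn.aemeasurable
    have h2 := w.aestronglyMeasurable_fn.aemeasurable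
    exact AEMeasurable.aestronglyMeasurable (by fun_prop)
  · have h0 : 0 ≤ |v.fn x| ^ (p - 1) := by positivity
    simp only [Pi.add_apply]
    rw [← abs_rpow_add_one hp, mul_assoc, mul_assoc, norm_mul, Real.norm_of_nonneg h0, ← mul_add]
    refine mul_le_mul_of_nonneg_left ?_ h0
    rw [Real.norm_eq_abs, abs_le]
    constructor <;> nlinarith [sq_nonneg (v.fn x + w.fn x), sq_nonneg (v.fn x - w.fn x)]

/-- A substitute for Hölder's inequality: the pointwise bound `abs_rpow_mul_sq_le` is applied to `w
/ ‖w‖`, and scaling back restores the quadratic dependence on `w`. The Sobolev inequality bounds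
both integrals. -/
theorem exists_integral_critical_le (hn : 3 ≤ n) (hΩb : Bornology.IsBounded Ω) (B : ℝ) :
    ∃ K : ℝ, 0 ≤ K ∧ ∀ v w : H01 Ω, ‖v‖ ≤ B →
      ∫ x in Ω, |v.fn x| ^ (criticalExponent n - 1 - 1) * w.fn x ^ 2 ≤ K * ‖w‖ ^ 2 := by
  have h2 := two_lt_criticalExponent hn
  set P := criticalExponent n - 1 with hP
  have hq : criticalExponent n = P + 1 := by ring
  have hp : 1 < P := by linarith
  obtain ⟨C, hC, hC0, -⟩ := exists_integral_abs_rpow_le (Ω := Ω) hn hΩb (q := P + 1) (by linarith)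
    hq.ge
  have hi := fun v : H01 Ω ↦ integrable_abs_rpow hn hΩb (q := P + 1) (by linarith) hq.ge v
  refine ⟨(C * |B|) ^ (P + 1) + C ^ (P + 1), by positivity, fun v w hv ↦ ?_⟩
  rcases eq_or_ne w 0 with rfl | hw
  · have : (fun x ↦ |v.fn x| ^ (P - 1) * (0 : H01 Ω).fn x ^ 2) =ᵐ[volume.restrict Ω] 0 := by
      filter_upwards [Lp.coeFn_zero ℝ 2 (volume.restrict Ω)] with x hx
      have : (0 : H01 Ω).fn x = 0 := hx
      simp [this]
    rw [integral_congr_ae this]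
    simp
  set τ := ‖w‖
  have hτ : 0 < τ := norm_pos_iff.2 hw
  have h1 : ∀ x, |v.fn x| ^ (P - 1) * w.fn x ^ 2 ≤
      τ ^ 2 * (|v.fn x| ^ (P + 1) + (τ ^ (P + 1))⁻¹ * |w.fn x| ^ (P + 1)) := fun x ↦ by
    have := mul_le_mul_of_nonneg_left (abs_rpow_mul_sq_le hp (v.fn x) (w.fn x / τ)) (sq_nonneg τ)
    rw [abs_div, abs_of_pos hτ, Real.div_rpow (abs_nonneg _) hτ.le] at this
    have e : τ ^ 2 * (|v.fn x| ^ (P - 1) * (w.fn x / τ) ^ 2) =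
      |v.fn x| ^ (P - 1) * w.fn x ^ 2 := by field_simp
    rw [e] at this
    rwa [inv_mul_eq_div]
  calc _ ≤ ∫ x in Ω, τ ^ 2 * (|v.fn x| ^ (P + 1) + (τ ^ (P + 1))⁻¹ * |w.fn x| ^ (P + 1)) :=
        integral_mono (integrable_abs_rpow_mul_sq hp (hi v) (hi w))
          (((hi v).add ((hi w).const_mul _)).const_mul _) h1
    _ = τ ^ 2 * ((∫ x in Ω, |v.fn x| ^ (P + 1)) +
          (τ ^ (P + 1))⁻¹ * ∫ x in Ω, |w.fn x| ^ (P + 1)) := by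
        rw [integral_const_mul, integral_add (hi v) ((hi w).const_mul _), integral_const_mul]
    _ ≤ τ ^ 2 * ((C * |B|) ^ (P + 1) + (τ ^ (P + 1))⁻¹ * (C * τ) ^ (P + 1)) := by
        gcongr
        · refine (hC v).trans (Real.rpow_le_rpow (by positivity) ?_ (by linarith))
          gcongr
          exact hv.trans (le_abs_self B)
        · exact hC w
    _ = _ := by
        rw [Real.mul_rpow hC0 hτ.le]
        field_simp

/-- The quadratic form `∫ |v|^(p-1) w²` is a small multiple of `‖∇w‖²` up to the weighted norm,
uniformly for `v` in a bounded set. -/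
theorem exists_integral_rpow_mul_sq_le (hn : 3 ≤ n) (hΩ : MeasurableSet Ω)
    (hΩb : Bornology.IsBounded Ω) {p : ℝ} (hp1 : 1 < p) (hp2 : p < criticalExponent n - 1) (B : ℝ)
    {ε : ℝ} (hε : 0 < ε) :
    ∃ C : ℝ, 0 ≤ C ∧ ∀ v w : H01 Ω, ‖v‖ ≤ B →
      ∫ x in Ω, |v.fn x| ^ (p - 1) * w.fn x ^ 2 ≤ ε * ‖w.1.2‖ ^ 2 + C * weightedNormSq w := by
  obtain ⟨Λ, hΛ⟩ := exists_weighted_embedding (Ω := Ω) hn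
  obtain ⟨R, hR⟩ := hΩb.exists_norm_le
  obtain ⟨K, hK0, hK⟩ := exists_integral_critical_le (Ω := Ω) hn hΩb B
  have h2 := two_lt_criticalExponent hn
  set P := criticalExponent n - 1 with hP
  have hPp : 1 < P := by linarith
  set δ := ε / (K + 1) with hδ
  have hδ0 : 0 < δ := by positivity
  obtain ⟨A, hA0, hA⟩ := exists_rpow_le_mul_rpow_add (r := p - 1) (s := P - 1) (by linarith)
    (by linarith) hδ0
  have hδK : δ * K ≤ ε := by
    have : δ * (K + 1) = ε := div_mul_cancel₀ _ (by positivity)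
    nlinarith
  have hi := fun v : H01 Ω ↦ integrable_abs_rpow hn hΩb (q := P + 1) (by linarith)
    (show P + 1 ≤ criticalExponent n by rw [hP]; linarith) v
  -- The full norm of `w` also contains `∫ w²`, which adds `ε` to `A`; `R²` converts `∫ w²` into the
  -- weighted norm.
  refine ⟨(ε + A) * R ^ 2, by positivity, fun v w hv ↦ ?_⟩
  have hw2 : Integrable (fun x ↦ w.fn x ^ 2) (volume.restrict Ω) :=
    (Lp.memLp w.1.1).integrable_sq
  have h1 : ∫ x in Ω, |v.fn x| ^ (p - 1) * w.fn x ^ 2 ≤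
      ∫ x in Ω, (δ * (|v.fn x| ^ (P - 1) * w.fn x ^ 2) + A * w.fn x ^ 2) := by
    refine integral_mono_of_nonneg (.of_forall fun x ↦ by positivity)
      (((integrable_abs_rpow_mul_sq hPp (hi v) (hi w)).const_mul _).add (hw2.const_mul _))
      (.of_forall fun x ↦ ?_)
    have := mul_le_mul_of_nonneg_right (hA _ (abs_nonneg (v.fn x))) (sq_nonneg (w.fn x))
    simp only
    linarith
  rw [integral_add ((integrable_abs_rpow_mul_sq hPp (hi v) (hi w)).const_mul _)
    (hw2.const_mul _), integral_const_mul, integral_const_mul] at h1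
  have h3 := mul_le_mul_of_nonneg_left (hK v w hv) hδ0.le
  have h4 := integral_sq_le (by lia) hΛ hΩ hR w
  have h5 := w.norm_sq_le
  have h6 : δ * (K * ‖w‖ ^ 2) ≤ ε * ‖w‖ ^ 2 := by
    rw [← mul_assoc]; gcongr
  have h7 := mul_le_mul_of_nonneg_left h5 hε.le
  have h8 := mul_le_mul_of_nonneg_left h4 (add_nonneg hε.le hA0)
  linarith

/-- The energy is semiconvex with respect to the weighted norm on bounded subsets of `H₀¹(Ω)`: for
`v` satisfying the weak equation tested with `v - z`, the energy at `z` is bounded below by the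
tangent at `v` up to a quadratic error. -/
theorem exists_energy_sub_le (hn : 3 ≤ n) (hΩ : MeasurableSet Ω)
    (hΩb : Bornology.IsBounded Ω) {p : ℝ} (hp1 : 1 < p) (hp2 : p < criticalExponent n - 1) (B : ℝ)
    {κ : ℝ} (hκ : 0 < κ) :
    ∃ C : ℝ, 0 ≤ C ∧ ∀ (v z : H01 Ω) (k : ℝ → ℝ) (s t a : ℝ), ‖v‖ ≤ B → ‖z‖ ≤ B → 0 ≤ k t →
      k t ≤ κ → k s ≤ k t →
      a + (∫ x in Ω, inner ℝ (v.grad x) ((v - z).grad x)) =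
        k t * ∫ x in Ω, |v.fn x| ^ (p - 1) * v.fn x * (v - z).fn x →
      energy p k v t - energy p k z s ≤ -a + C * weightedNormSq (v - z) := by
  -- The quadratic error occurs once with `v` and once with `z`, multiplied by at most `κ p`; this
  -- `ε` makes the total gradient term exactly `½ ‖∇w‖²`, which `e3` supplies with the opposite
  -- sign.
  obtain ⟨C, hC0, hC⟩ := exists_integral_rpow_mul_sq_le hn hΩ hΩb hp1 hp2 B
    (ε := 1 / (4 * κ * p)) (by positivity)
  refine ⟨2 * κ * p * C, by positivity, fun v z k s t a hv hz hkt hkκ hks heq ↦ ?_⟩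
  set w := v - z with hw
  have hi := fun v : H01 Ω ↦ integrable_abs_rpow hn hΩb (q := p + 1) (by linarith)
    (show p + 1 ≤ criticalExponent n by linarith) v
  have hp0 : 0 < p := by linarith
  -- the Dirichlet part
  have e1 : ∫ x in Ω, inner ℝ (v.grad x) (w.grad x) = inner ℝ v.1.2 w.1.2 := by
    rw [L2.inner_def]; rfl
  have e2 : z.1.2 = v.1.2 - w.1.2 := by simp [hw]
  have e3 : 1 / 2 * ‖v.1.2‖ ^ 2 - 1 / 2 * ‖z.1.2‖ ^ 2 =
      inner ℝ v.1.2 w.1.2 - 1 / 2 * ‖w.1.2‖ ^ 2 := by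
    rw [e2, norm_sub_sq_real]; ring
  -- the nonlinear part
  have h1 : (∫ x in Ω, |v.fn x| ^ (p - 1) * v.fn x * w.fn x) -
      p * ((∫ x in Ω, |v.fn x| ^ (p - 1) * w.fn x ^ 2) +
        ∫ x in Ω, |z.fn x| ^ (p - 1) * w.fn x ^ 2) ≤
      1 / (p + 1) * (∫ x in Ω, |v.fn x| ^ (p + 1)) -
        1 / (p + 1) * ∫ x in Ω, |z.fn x| ^ (p + 1) := by
    have i1 := integrable_abs_rpow_mul_mul hp1 (hi v) (hi w)
    have i2 := integrable_abs_rpow_mul_sq hp1 (hi v) (hi w)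
    have i3 := integrable_abs_rpow_mul_sq hp1 (hi z) (hi w)
    have i4 : Integrable (fun x ↦ p * (|v.fn x| ^ (p - 1) * w.fn x ^ 2 +
      |z.fn x| ^ (p - 1) * w.fn x ^ 2)) (volume.restrict Ω) := (i2.add i3).const_mul _
    rw [← integral_add i2 i3, ← integral_const_mul, ← integral_const_mul, ← integral_const_mul,
      ← integral_sub i1 i4,
      ← integral_sub ((hi v).const_mul _) ((hi z).const_mul _)]
    refine integral_mono_ae (i1.sub i4)
      (((hi v).const_mul _).sub ((hi z).const_mul _)) ?_
    filter_upwards [H01.fn_sub v z] with x hx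
    rw [← hw, Pi.sub_apply] at hx
    simp only [hx]
    exact abs_rpow_tangent_le hp1 _ _
  have h2 := hC v w hv
  have h3 := hC z w hz
  have hz0 : 0 ≤ ∫ x in Ω, |z.fn x| ^ (p + 1) := integral_nonneg fun x ↦ by positivity
  have h4 := mul_le_mul_of_nonneg_left h1 hkt
  set X := (∫ x in Ω, |v.fn x| ^ (p - 1) * w.fn x ^ 2) +
    ∫ x in Ω, |z.fn x| ^ (p - 1) * w.fn x ^ 2
  have hX0 : 0 ≤ X := add_nonneg (integral_nonneg fun x ↦ by positivity)
    (integral_nonneg fun x ↦ by positivity)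
  have h5 : k t * (p * X) ≤ 1 / 2 * ‖w.1.2‖ ^ 2 + 2 * κ * p * C * weightedNormSq w := by
    calc k t * (p * X) ≤ κ * (p * X) := by gcongr
      _ ≤ κ * (p * (2 * (1 / (4 * κ * p) * ‖w.1.2‖ ^ 2 + C * weightedNormSq w))) := by
        gcongr; linarith
      _ = _ := by field_simp; ring
  -- Monotonicity of `k` enters here: passing to the later time can only lower the energy.
  have h6 : k s / (p + 1) * (∫ x in Ω, |z.fn x| ^ (p + 1)) ≤
      k t * (1 / (p + 1) * ∫ x in Ω, |z.fn x| ^ (p + 1)) := by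
    rw [← mul_assoc, mul_one_div]; gcongr
  rw [energy, energy, H01.integral_norm_grad_sq, H01.integral_norm_grad_sq]
  rw [e1] at heq
  have h7 : k t / (p + 1) * (∫ x in Ω, |v.fn x| ^ (p + 1)) =
      k t * (1 / (p + 1) * ∫ x in Ω, |v.fn x| ^ (p + 1)) := by ring
  linarith

end WeightedHeat

/-! ### Energy inequality, life span and blow-up of weak solutions -/

namespace WeightedHeat

theorem hasDerivAt_half_norm_sq {H : Type*} [NormedAddCommGroup H] [InnerProductSpace ℝ H]
    {Y : ℝ → H} {y : H} {t : ℝ} (h : HasDerivAt Y y t) :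
    HasDerivAt (fun t ↦ 1 / 2 * ‖Y t‖ ^ 2) (inner ℝ (Y t) y) t := by
  refine (h.norm_sq.const_mul (1 / 2)).congr_deriv ?_
  ring

theorem inner_sq_le {H : Type*} [NormedAddCommGroup H] [InnerProductSpace ℝ H] (x y : H) :
    (inner ℝ x y) ^ 2 ≤ 2 * (1 / 2 * ‖x‖ ^ 2) * ‖y‖ ^ 2 := by
  have h := real_inner_mul_inner_self_le x y
  rw [real_inner_self_eq_norm_sq, real_inner_self_eq_norm_sq] at h
  linarith

/-- Increments of the curve are dominated by those of `∫ ‖g‖`, and the square of the norm is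
Lipschitz on bounded sets. -/
theorem absolutelyContinuousOnInterval_half_norm_sq {H : Type*} [NormedAddCommGroup H]
    [InnerProductSpace ℝ H] {g : ℝ → H} {b : ℝ}
    (hg : IntervalIntegrable g volume 0 b) (y : H) :
    AbsolutelyContinuousOnInterval (fun t ↦ 1 / 2 * ‖y + ∫ s in (0 : ℝ)..t, g s‖ ^ 2) 0 b := by
  set Y := fun t ↦ y + ∫ s in (0 : ℝ)..t, g s
  have hgi : ∀ s ∈ uIcc 0 b, ∀ t ∈ uIcc 0 b, IntervalIntegrable g volume s t := fun s hs t ht ↦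
    hg.mono_set (uIcc_subset_uIcc hs ht)
  have h0 : (0 : ℝ) ∈ uIcc 0 b := left_mem_uIcc
  have hAC := hg.norm.absolutelyContinuousOnInterval_intervalIntegral (c := 0) h0
  have hY : ∀ s ∈ uIcc 0 b, ∀ t ∈ uIcc 0 b, ‖Y t - Y s‖ ≤
      dist (∫ r in (0 : ℝ)..t, ‖g r‖) (∫ r in (0 : ℝ)..s, ‖g r‖) := fun s hs t ht ↦ by
    rw [Real.dist_eq, intervalIntegral.integral_interval_sub_left (hgi 0 h0 t ht).norm
      (hgi 0 h0 s hs).norm]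
    simp only [Y, add_sub_add_left_eq_sub]
    rw [intervalIntegral.integral_interval_sub_left (hgi 0 h0 t ht) (hgi 0 h0 s hs)]
    exact intervalIntegral.norm_integral_le_abs_integral_norm
  obtain ⟨K, hK⟩ := hAC.exists_bound
  have hYK : ∀ t ∈ uIcc 0 b, ‖Y t‖ ≤ ‖y‖ + K := fun t ht ↦ by
    have h1 := hY 0 h0 t ht
    rw [Real.dist_eq, intervalIntegral.integral_same, sub_zero] at h1
    have h2 : Y 0 = y := by simp [Y]
    rw [h2] at h1
    have h3 := norm_le_norm_add_norm_sub' (Y t) y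
    have h4 := hK t ht
    rw [Real.norm_eq_abs] at h4
    linarith
  refine hAC.of_dist_le (K := ‖y‖ + K) fun t ht s hs ↦ ?_
  change dist (1 / 2 * ‖Y t‖ ^ 2) (1 / 2 * ‖Y s‖ ^ 2) ≤ _
  have e : 1 / 2 * ‖Y t‖ ^ 2 - 1 / 2 * ‖Y s‖ ^ 2 =
    1 / 2 * ((‖Y t‖ + ‖Y s‖) * (‖Y t‖ - ‖Y s‖)) := by ring
  have h1 := hYK t ht
  have h2 := hYK s hs
  have h3 : |‖Y t‖ - ‖Y s‖| ≤ _ := (abs_norm_sub_norm_le _ _).trans (hY s hs t ht)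
  rw [Real.dist_eq, e, abs_mul, abs_mul, abs_of_nonneg (add_nonneg (norm_nonneg _) (norm_nonneg _)),
    abs_of_nonneg (by norm_num : (0 : ℝ) ≤ 1 / 2)]
  have h5 := norm_nonneg (Y t)
  have h4 : (‖Y t‖ + ‖Y s‖) * |‖Y t‖ - ‖Y s‖| ≤ (2 * (‖y‖ + K)) *
      dist (∫ r in (0 : ℝ)..t, ‖g r‖) (∫ r in (0 : ℝ)..s, ‖g r‖) := by
    gcongr <;> linarith
  linarith

variable {n : ℕ} {Ω : Set (EuclideanSpace ℝ (Fin n))} {p : ℝ} {k : ℝ → ℝ}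

theorem integrableOn_energy (hn : 3 ≤ n) (hΩb : Bornology.IsBounded Ω) (hp1 : 1 < p)
    (hp2 : p < criticalExponent n - 1) (hk : ContinuousOn k (Ici 0)) {T κ B : ℝ}
    (hkκ : ∀ t ∈ Ioo 0 T, |k t| ≤ κ) {u : ℝ → H01 Ω}
    (hu : AEStronglyMeasurable u (volume.restrict (Ioo 0 T)))
    (huB : ∀ᵐ t ∂(volume.restrict (Ioo 0 T)), ‖u t‖ ≤ B) :
    IntegrableOn (fun t ↦ energy p k (u t) t) (Ioo 0 T) := by
  obtain ⟨C, hC, hC0, hcont⟩ := exists_integral_abs_rpow_le (Ω := Ω) hn hΩb (q := p + 1)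
    (by linarith) (by linarith)
  have hkm : AEStronglyMeasurable k (volume.restrict (Ioo 0 T)) :=
    (hk.mono (Ioo_subset_Icc_self.trans Icc_subset_Ici_self)).aestronglyMeasurable measurableSet_Ioo
  have hgrad : Continuous fun v : H01 Ω ↦ ∫ x in Ω, ‖v.grad x‖ ^ 2 := by
    simp only [H01.integral_norm_grad_sq]
    exact (continuous_snd.comp continuous_subtype_val).norm.pow 2
  refine Integrable.of_bound (C := 1 / 2 * B ^ 2 + κ / (p + 1) * (C * B) ^ (p + 1)) ?_ ?_
  · exact ((hgrad.comp_aestronglyMeasurable hu).const_mul _).sub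
      ((hkm.mul aestronglyMeasurable_const).mul (hcont.comp_aestronglyMeasurable hu))
  · filter_upwards [huB, ae_restrict_mem measurableSet_Ioo] with t ht htT
    have hp0 : 0 < p + 1 := by linarith
    have h1 := hkκ t htT
    have h2 : ∫ x in Ω, |(u t).fn x| ^ (p + 1) ≤ (C * B) ^ (p + 1) := (hC _).trans
      (Real.rpow_le_rpow (by positivity) (by gcongr) hp0.le)
    have h3 : 0 ≤ ∫ x in Ω, |(u t).fn x| ^ (p + 1) := integral_nonneg fun x ↦ by positivity
    have h4 : ‖(u t).1.2‖ ≤ B := (u t).norm_snd_le.trans ht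
    rw [energy, H01.integral_norm_grad_sq]
    refine (norm_sub_le _ _).trans ?_
    rw [norm_mul _ (∫ x in Ω, |(u t).fn x| ^ (p + 1)), Real.norm_of_nonneg h3, norm_div,
      Real.norm_of_nonneg hp0.le, Real.norm_of_nonneg (by positivity : 0 ≤ 1 / 2 * ‖(u t).1.2‖ ^ 2)]
    have h5 : ‖k t‖ ≤ κ := h1
    have h6 : 0 ≤ κ := (abs_nonneg _).trans h1
    gcongr

section solution

variable {u₀ : H01 Ω} {T : ℝ} {u : ℝ → H01 Ω} {ut : ℝ → Lp ℝ 2 (weightedMeasure Ω)}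
  {Λ : H01 Ω →L[ℝ] Lp ℝ 2 (weightedMeasure Ω)}

theorem HasTimeDeriv.embedding_eq (h : HasTimeDeriv T u ut)
    (hΛ : ∀ v, Λ v =ᵐ[weightedMeasure Ω] v.fn) {t : ℝ} (ht : t ∈ Ico 0 T) :
    Λ (u t) = Λ (u 0) + ∫ s in (0 : ℝ)..t, ut s := by
  apply Lp.ext
  filter_upwards [hΛ (u t), hΛ (u 0), Lp.coeFn_add (Λ (u 0)) (∫ s in (0 : ℝ)..t, ut s),
    weightedMeasure_absolutelyContinuous.ae_eq (h.eq_integral t ht)] with x h1 h2 h3 h4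
  rw [h1, h3, h4, Pi.add_apply, h2]

theorem HasTimeDeriv.intervalIntegrable (h : HasTimeDeriv T u ut) {s t : ℝ} (hs : s ∈ Ico 0 T)
    (ht : t ∈ Ico 0 T) : IntervalIntegrable ut volume s t := by
  have h1 : IntegrableOn ut (Ioo 0 T) := h.memLp.integrable one_le_two
  rw [intervalIntegrable_iff]
  refine h1.mono_set fun r hr ↦ ?_
  exact ⟨(le_min hs.1 ht.1).trans_lt hr.1, hr.2.trans_lt (max_lt hs.2 ht.2)⟩

theorem HasTimeDeriv.intervalIntegrable_norm_sq (h : HasTimeDeriv T u ut) {s t : ℝ}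
    (hs : s ∈ Ico 0 T) (ht : t ∈ Ico 0 T) :
    IntervalIntegrable (fun r ↦ ‖ut r‖ ^ 2) volume s t := by
  have h1 : IntegrableOn (fun r ↦ ‖ut r‖ ^ 2) (Ioo 0 T) :=
    (memLp_two_iff_integrable_sq_norm h.memLp.1).1 h.memLp
  rw [intervalIntegrable_iff]
  refine h1.mono_set fun r hr ↦ ?_
  exact ⟨(le_min hs.1 ht.1).trans_lt hr.1, hr.2.trans_lt (max_lt hs.2 ht.2)⟩

/-- The energy inequality for weak solutions. -/
theorem energy_inequality (hn : 3 ≤ n) (hΩ : MeasurableSet Ω) (hΩb : Bornology.IsBounded Ω)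
    (hp1 : 1 < p) (hp2 : p < criticalExponent n - 1) (hk : ContinuousOn k (Ici 0))
    (hkm : MonotoneOn k (Ici 0)) (hk0 : 0 < k 0)
    (hΛ : ∀ v, Λ v =ᵐ[weightedMeasure Ω] v.fn)
    (hu : MemLp u ⊤ (volume.restrict (Ioo 0 T))) (hut : HasTimeDeriv T u ut)
    (hweak : ∀ᵐ t ∂(volume.restrict (Ioo 0 T)), ∀ v : H01 Ω,
      (∫ x in Ω, ut t x * v.fn x / ‖x‖ ^ 2) + (∫ x in Ω, inner ℝ ((u t).grad x) (v.grad x)) =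
        k t * ∫ x in Ω, |(u t).fn x| ^ (p - 1) * (u t).fn x * v.fn x) :
    ∀ᵐ t, t ∈ Ioo 0 T →
      energy p k (u t) t + ∫ s in (0 : ℝ)..t, ‖ut s‖ ^ 2 ≤ energy p k (u 0) 0 := by
  rcases le_or_gt T 0 with hT | hT
  · exact .of_forall fun t ht ↦ absurd (ht.1.trans ht.2) hT.not_gt
  -- The essential bound on `(0,T)` says nothing about time 0, hence the maximum.
  set B := max (eLpNorm u ⊤ (volume.restrict (Ioo 0 T))).toReal ‖u 0‖ with hB
  have huB : ∀ᵐ t ∂(volume.restrict (Ioo 0 T)), ‖u t‖ ≤ B := by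
    filter_upwards [enorm_ae_le_eLpNormEssSup u (volume.restrict (Ioo 0 T))] with t ht
    rw [← eLpNorm_exponent_top] at ht
    have := ENNReal.toReal_mono hu.2.ne ht
    rw [toReal_enorm] at this
    exact this.trans (le_max_left _ _)
  have hkpos : ∀ t, 0 ≤ t → 0 < k t := fun t ht ↦ hk0.trans_le (hkm self_mem_Ici ht ht)
  have hkT : ∀ t ∈ Ioo 0 T, k t ≤ k T := fun t ht ↦ hkm ht.1.le hT.le ht.2.le
  obtain ⟨C, hC0, hC⟩ := exists_energy_sub_le hn hΩ hΩb hp1 hp2 B (hkpos T hT.le)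
  refine energy_add_dissipation_le (C := C) (j := fun t ↦ energy p k (u t) t) hC0
    ((ae_restrict_iff' measurableSet_Ioo).1 (huB.and hweak)) hut.memLp
    (integrableOn_energy hn hΩb hp1 hp2 hk
      (fun t ht ↦ (abs_of_pos (hkpos t ht.1.le)).trans_le (hkT t ht)) hu.1 huB) ?_
  rintro t ⟨htB, htw⟩ htT s hs hsS
  have hsB : ‖u s‖ ≤ B := by
    rcases hsS with rfl | h
    · exact le_max_right _ _
    · exact h.1
  have hsT : s ∈ Ico 0 T := ⟨hs.1, hs.2.trans htT.2⟩
  have htT' : t ∈ Ico 0 T := ⟨htT.1.le, htT.2⟩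
  have h0T : (0 : ℝ) ∈ Ico 0 T := ⟨le_rfl, hT⟩
  have e : Λ (u t - u s) = ∫ r in s..t, ut r := by
    rw [map_sub, hut.embedding_eq hΛ hsT, hut.embedding_eq hΛ htT', add_sub_add_left_eq_sub,
      intervalIntegral.integral_interval_sub_left (hut.intervalIntegrable h0T htT')
      (hut.intervalIntegrable h0T hsT)]
  -- The admissible replacement for `u_t` as a test function; its image in the weighted space is the
  -- integral of `ut`.
  have h1 := htw (u t - u s)
  rw [← inner_embedding hΛ, e] at h1
  have h2 := hC (u t) (u s) k s t _ htB hsB (hkpos t htT.1.le).le (hkT t htT)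
    (hkm hs.1 htT.1.le hs.2.le) h1
  rwa [weightedNormSq_eq hΛ, e] at h2

/-- If the weighted norm vanished, so would `v` almost everywhere, leaving only the nonnegative
Dirichlet term in the energy. -/
theorem weightedNormSq_pos_of_energy_neg (hn : n ≠ 0) (hp1 : 1 < p)
    (hΛ : ∀ v, Λ v =ᵐ[weightedMeasure Ω] v.fn) {v : H01 Ω} {t : ℝ} (hJ : energy p k v t < 0) :
    0 < weightedNormSq v := by
  by_contra! h
  rw [weightedNormSq_eq hΛ] at h
  have h0 : Λ v = 0 := norm_eq_zero.1 (by nlinarith [norm_nonneg (Λ v)])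
  have h1 : v.fn =ᵐ[weightedMeasure Ω] 0 := by
    filter_upwards [hΛ v, Lp.coeFn_zero ℝ 2 (weightedMeasure Ω)] with x hx hx0
    rw [← hx, h0, hx0]
  have h2 : ∫ x in Ω, |v.fn x| ^ (p + 1) = 0 := by
    refine integral_eq_zero_of_ae ?_
    filter_upwards [(volume_absolutelyContinuous_weightedMeasure hn).ae_eq h1] with x hx
    simp [hx, Real.zero_rpow (by linarith : p + 1 ≠ 0)]
  rw [energy, h2, mul_zero, sub_zero] at hJ
  have : 0 ≤ ∫ x in Ω, ‖v.grad x‖ ^ 2 := integral_nonneg fun x ↦ by positivity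
  linarith

/-- Testing with `v` itself gives `⟨Λ v, f⟩ = -(p+1) J(v;t) + (p-1)/2 ‖∇v‖²`, whose last term is
dropped. For a solution the left side is the derivative of `½ ‖u/|x|‖²`. -/
theorem le_inner_embedding_of_energy_le (hp1 : 1 < p)
    (hΛ : ∀ v, Λ v =ᵐ[weightedMeasure Ω] v.fn) {v : H01 Ω} {f : Lp ℝ 2 (weightedMeasure Ω)}
    {t D J₀ : ℝ}
    (hw : (∫ x in Ω, f x * v.fn x / ‖x‖ ^ 2) + (∫ x in Ω, inner ℝ (v.grad x) (v.grad x)) =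
      k t * ∫ x in Ω, |v.fn x| ^ (p - 1) * v.fn x * v.fn x)
    (hE : energy p k v t + D ≤ J₀) : (p + 1) * (-J₀ + D) ≤ inner ℝ (Λ v) f := by
  rw [← inner_embedding hΛ, real_inner_comm] at hw
  simp only [abs_rpow_add_one hp1, real_inner_self_eq_norm_sq] at hw
  rw [energy] at hE
  have h7 : 0 ≤ ∫ x in Ω, ‖v.grad x‖ ^ 2 := integral_nonneg fun x ↦ by positivity
  have h8 : (p + 1) * (k t / (p + 1) * ∫ x in Ω, |v.fn x| ^ (p + 1)) =
    k t * ∫ x in Ω, |v.fn x| ^ (p + 1) := by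
      have : p + 1 ≠ 0 := by linarith
      field_simp
  have h9 := mul_le_mul_of_nonneg_left hE (by linarith : 0 ≤ p + 1)
  have h10 := mul_nonneg (sub_nonneg.2 hp1.le) h7
  linarith

/-- A weak solution with negative initial energy has nondecreasing weighted norm, and its life span
is bounded in terms of the data. -/
theorem IsWeakSolution.monotoneOn_and_le (hn : 3 ≤ n) (hΩ : MeasurableSet Ω)
    (hΩb : Bornology.IsBounded Ω) (hp1 : 1 < p) (hp2 : p < criticalExponent n - 1)
    (hk : ContinuousOn k (Ici 0)) (hkm : MonotoneOn k (Ici 0)) (hk0 : 0 < k 0)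
    (hJ : energy p k u₀ 0 < 0) (h : IsWeakSolution p k u₀ T u) :
    MonotoneOn (fun t ↦ weightedNormSq (u t)) (Ico 0 T) ∧
      T ≤ weightedNormSq u₀ / ((1 - p ^ 2) * energy p k u₀ 0) := by
  obtain ⟨Λ, hΛ⟩ := exists_weighted_embedding (Ω := Ω) hn
  obtain ⟨ut, hut, hweak⟩ := h.weak
  have hu₀ := weightedNormSq_pos_of_energy_neg (by lia) hp1 hΛ hJ
  have hE := energy_inequality hn hΩ hΩb hp1 hp2 hk hkm hk0 hΛ h.memLp hut hweak
  rw [h.initial] at hE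
  generalize energy p k u₀ 0 = J₀ at hE hJ ⊢
  have hT := h.pos
  have h0T : (0 : ℝ) ∈ Ico 0 T := ⟨le_rfl, hT⟩
  set L : ℝ → ℝ := fun t ↦ 1 / 2 * ‖Λ u₀ + ∫ s in (0 : ℝ)..t, ut s‖ ^ 2 with hL
  set M : ℝ → ℝ := fun t ↦ -J₀ + ∫ s in (0 : ℝ)..t, ‖ut s‖ ^ 2 with hM
  have hLu : ∀ t ∈ Ico 0 T, L t = 1 / 2 * weightedNormSq (u t) := fun t ht ↦ by
    rw [weightedNormSq_eq hΛ, hut.embedding_eq hΛ ht, h.initial]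
  have hM0 : M 0 = -J₀ := by simp [hM]
  have hMpos : ∀ t, 0 ≤ t → M 0 ≤ M t := fun t ht ↦ by
    rw [hM0]
    have := intervalIntegral.integral_nonneg (μ := volume) ht fun r _ ↦ sq_nonneg ‖ut r‖
    simp only [hM]
    linarith
  have hLAC : ∀ b ∈ Ico 0 T, AbsolutelyContinuousOnInterval L 0 b := fun b hb ↦
    absolutelyContinuousOnInterval_half_norm_sq (hut.intervalIntegrable h0T hb) _
  have hMAC : ∀ b ∈ Ico 0 T, AbsolutelyContinuousOnInterval M 0 b := fun b hb ↦
    ((hut.intervalIntegrable_norm_sq h0T hb).absolutelyContinuousOnInterval_intervalIntegral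
      (c := 0) left_mem_uIcc).of_dist_le (K := 1) fun x _ y _ ↦ by simp [hM]
  have hder : ∀ b ∈ Ico 0 T, ∀ᵐ t, t ∈ Ioo 0 b → ∃ l m, HasDerivAt L l t ∧ HasDerivAt M m t ∧
      2 * ((p + 1) / 2) * M t ≤ l ∧ l ^ 2 ≤ 2 * L t * m := fun b hb ↦ by
    filter_upwards [hE, (ae_restrict_iff' measurableSet_Ioo).1 hweak,
      (hut.intervalIntegrable h0T hb).ae_hasDerivAt_integral,
      (hut.intervalIntegrable_norm_sq h0T hb).ae_hasDerivAt_integral] with t h1 h2 h3 h4 ht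
    have htT : t ∈ Ioo 0 T := ⟨ht.1, ht.2.trans hb.2⟩
    have htb : t ∈ uIcc 0 b := by
      rw [uIcc_of_le hb.1]; exact Ioo_subset_Icc_self ht
    have hY : Λ u₀ + ∫ s in (0 : ℝ)..t, ut s = Λ (u t) := by
      rw [hut.embedding_eq hΛ (Ioo_subset_Ico_self htT), h.initial]
    have dL : HasDerivAt L (inner ℝ (Λ (u t)) (ut t)) t := by
      rw [← hY]
      exact hasDerivAt_half_norm_sq ((h3 htb 0 left_mem_uIcc).const_add (Λ u₀))
    have dM : HasDerivAt M (‖ut t‖ ^ 2) t := (h4 htb 0 left_mem_uIcc).const_add (-J₀)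
    have hLt : L t = 1 / 2 * ‖Λ (u t)‖ ^ 2 := by rw [hL, ← hY]
    refine ⟨_, _, dL, dM, ?_, ?_⟩
    · have h5 := le_inner_embedding_of_energy_le hp1 hΛ (h2 htT (u t)) (h1 htT)
      rw [mul_div_cancel₀ _ two_ne_zero]
      exact h5
    · rw [hLt]
      exact inner_sq_le _ _
  have hL0 : 0 < L 0 := by
    rw [hLu 0 h0T, h.initial]
    positivity
  refine ⟨fun s hs t ht hst ↦ ?_, le_of_forall_lt_imp_le_of_dense fun b hb ↦ ?_⟩
  -- Absolute continuity is available only on `[0,b]` with `b < T`; any `b` between `t` and `T`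
  -- serves.
  · have hb : (t + T) / 2 ∈ Ico 0 T := ⟨by linarith [ht.1], by linarith [ht.2]⟩
    have hmono : MonotoneOn L (Icc 0 ((t + T) / 2)) := by
      refine monotoneOn_of_ae_hasDerivAt (hLAC _ hb) hb.1 ?_
      filter_upwards [hder _ hb] with r hr hr'
      obtain ⟨l, m, hl, -, hlm, -⟩ := hr hr'
      have := hMpos r hr'.1.le
      exact ⟨l, hl, le_trans (mul_nonneg (by linarith) (by linarith)) hlm⟩
    have := hmono ⟨hs.1, by linarith [ht.2]⟩ ⟨ht.1, by linarith [ht.2]⟩ hst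
    rw [hLu s hs, hLu t ht] at this
    simp only
    linarith
  · have hbT : max b 0 ∈ Ico 0 T := ⟨le_max_right _ _, max_lt hb hT⟩
    have h1 := le_of_superlinear_growth (by linarith : 1 < (p + 1) / 2) hbT.1 (hLAC _ hbT)
      (hMAC _ hbT) hL0 (by rw [hM0]; linarith) (fun t ht ↦ hMpos t ht.1) (hder _ hbT)
    rw [hM0, hLu 0 h0T, h.initial] at h1
    refine (le_max_left b 0).trans (h1.trans_eq ?_)
    -- With `α = (p+1)/2`, the factor ½ here cancels the ½ in `L 0`.
    have e : 2 * ((p + 1) / 2) * ((p + 1) / 2 - 1) * -J₀ = 1 / 2 * ((1 - p ^ 2) * J₀) := by ring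
    rw [e, mul_div_mul_left _ _ (by norm_num)]

/-- A weak solution with negative initial energy and maximal existence time `Tstar` blows up. -/
theorem IsMaximalExistenceTime.exists_blowsUpAt (hn : 3 ≤ n) (hΩ : MeasurableSet Ω)
    (hΩb : Bornology.IsBounded Ω) (hp1 : 1 < p) (hp2 : p < criticalExponent n - 1)
    (hk : ContinuousOn k (Ici 0)) (hkm : MonotoneOn k (Ici 0)) (hk0 : 0 < k 0)
    (hJ : energy p k u₀ 0 < 0) {Tstar : EReal} (h : IsMaximalExistenceTime p k u₀ u Tstar) :
    ∃ T₀ : ℝ, Tstar = (T₀ : EReal) ∧ BlowsUpAt p k u₀ u T₀ ∧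
      T₀ ≤ weightedNormSq u₀ / ((1 - p ^ 2) * energy p k u₀ 0) := by
  have hsol := fun T (hT : IsWeakSolution p k u₀ T u) ↦
    hT.monotoneOn_and_le hn hΩ hΩb hp1 hp2 hk hkm hk0 hJ
  set β := weightedNormSq u₀ / ((1 - p ^ 2) * energy p k u₀ 0)
  have hle : ∀ T : ℝ, 0 < T → (T : EReal) < Tstar → T ≤ β := fun T h0 hT ↦
    (hsol T (h.sol T h0 hT)).2
  have hpos := h.pos
  induction Tstar with
  | bot => simp at hpos
  | top =>
    -- A global solution would exist beyond the life span bound `β`.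
    have := hle (max β 0 + 1) (by positivity) (EReal.coe_lt_top _)
    linarith [le_max_left β 0]
  | coe T₀ =>
    have hT₀ : 0 < T₀ := by exact_mod_cast hpos
    have hsol' : ∀ T ∈ Ioo 0 T₀, IsWeakSolution p k u₀ T u := fun T hT ↦
      h.sol T hT.1 (by exact_mod_cast hT.2)
    refine ⟨T₀, rfl, ⟨hT₀, hsol', tendsto_atTop.2 fun A ↦ ?_⟩,
      le_of_forall_lt_imp_le_of_dense fun b hb ↦ ?_⟩
    · have hub := h.unbounded T₀ rfl
      rw [not_bddAbove_iff] at hub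
      -- One time at which the weighted norm exceeds `A` is enough, since the norm is nondecreasing
      -- from there on.
      obtain ⟨_, ⟨s, hs, rfl⟩, hA⟩ := hub A
      filter_upwards [Ioo_mem_nhdsLT hs.2] with t ht
      have hT : (t + T₀) / 2 ∈ Ioo 0 T₀ := ⟨by linarith [ht.1, hs.1], by linarith [ht.2]⟩
      have := (hsol _ (hsol' _ hT)).1 ⟨hs.1, by linarith [ht.1, ht.2]⟩
        ⟨hs.1.trans ht.1.le, by linarith [ht.2]⟩ ht.1.le
      exact hA.le.trans this
    · have hb' : max b (T₀ / 2) < T₀ := max_lt hb (by linarith)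
      exact (le_max_left _ _).trans (hle _ (lt_max_of_lt_right (half_pos hT₀))
        (by exact_mod_cast hb'))

end solution

end WeightedHeat

theorem theorem3p1 (n : ℕ) (hn : 3 ≤ n) (Ω : Set (EuclideanSpace ℝ (Fin n)))
    (hΩo : IsOpen Ω) (hΩb : Bornology.IsBounded Ω) (hΩ0 : (0 : EuclideanSpace ℝ (Fin n)) ∈ Ω)
    (p : ℝ) (hp1 : 1 < p) (hp2 : p < ((n : ℝ) + 2) / ((n : ℝ) - 2))
    (k : ℝ → ℝ) (hk : ContDiffOn ℝ 1 k (Set.Ici 0)) (hk0 : 0 < k 0)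
    (hk' : ∀ t : ℝ, 0 ≤ t → 0 ≤ derivWithin k (Set.Ici 0) t)
    (u₀ : WeightedHeat.H01 Ω) (hu₀ : ∀ᵐ x ∂(MeasureTheory.volume.restrict Ω), 0 ≤ u₀.fn x)
    (hJ : WeightedHeat.energy p k u₀ 0 < 0)
    (u : ℝ → WeightedHeat.H01 Ω) :
    (∀ T : ℝ, WeightedHeat.IsWeakSolution p k u₀ T u →
      T ≤ WeightedHeat.weightedNormSq u₀ / ((1 - p ^ 2) * WeightedHeat.energy p k u₀ 0)) ∧
    (∀ Tstar : EReal, WeightedHeat.IsMaximalExistenceTime p k u₀ u Tstar →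
      ∃ T₀ : ℝ, Tstar = (T₀ : EReal) ∧ WeightedHeat.BlowsUpAt p k u₀ u T₀ ∧
        T₀ ≤ WeightedHeat.weightedNormSq u₀ /
          ((1 - p ^ 2) * WeightedHeat.energy p k u₀ 0)) := by
  have hp2' : p < WeightedHeat.criticalExponent n - 1 := by
    have hn' : (3 : ℝ) ≤ n := by exact_mod_cast hn
    have h2 : (n : ℝ) - 2 ≠ 0 := by linarith
    refine hp2.trans_eq ?_
    rw [WeightedHeat.criticalExponent]
    field_simp
    ring
  have hkm : MonotoneOn k (Ici 0) := by
    refine monotoneOn_of_deriv_nonneg (convex_Ici 0) hk.continuousOn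
      ((hk.differentiableOn one_ne_zero).mono interior_subset) fun t ht ↦ ?_
    rw [← derivWithin_of_mem_nhds (mem_interior_iff_mem_nhds.1 ht)]
    exact hk' t (interior_subset ht)
  exact ⟨fun T hT ↦ (hT.monotoneOn_and_le hn hΩo.measurableSet hΩb hp1 hp2' hk.continuousOn hkm
    hk0 hJ).2, fun Tstar hT ↦ hT.exists_blowsUpAt hn hΩo.measurableSet hΩb hp1 hp2'
    hk.continuousOn hkm hk0 hJ⟩
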